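/- All graphs are finite. A graph is **matching covered** if it is connected, has at least two vertices, and each of its edges lies in a perfect matching. A **brick** is a $3$-connected loopless graph (on at least four vertices, parallel edges allowed) such that deleting any two distinct vertices leaves a graph with a perfect matching. Let $G$ be a simple **$R$-brick**, that is, a simple brick together with a fixed pair $R$ of its edges such that $H := G - R$ is bipartite and matching covered; let $V(R)$ be the set of ends of the edges of $R$. The **retract** of $G-e$ is the (possibly non-simple) graph obtained from $G-e$ by contracting every edge incident with a vertex of degree two. An edge $e$ of $H$ is **$R$-compatible** if $G-e$ and $H-e$ are both matching covered. An $R$-compatible edge $e$ is **$R$-thin** if the retract of $G-e$ is a brick, and **strictly $R$-thin** if moreover this retract is simple. A **barrier** of a graph $F$ is a nonempty set $S$ of vertices such that $F-S$ has exactly $|S|$ odd components; it is nontrivial if $|S|\ge 2$. The **index** of $e$ is the number of maximal barriers of $G-e$ that are nontrivial. A **partial biwheel** consists of a path $x_0x_1\cdots x_{2j+1}$ with $j\ge 1$ and two further distinct vertices $u,w$ (the **hubs**), with $u$ joined to $x_0,x_2,\dots,x_{2j}$ and $w$ joined to $x_1,x_3,\dots,x_{2j+1}$. Its **ends** are $x_0$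 and $x_{2j+1}$; the edges at the hubs are its **spokes**, and all spokes other than $ux_0$ and $wx_{2j+1}$ are **internal**. A subgraph $K$ of $H$ that is a partial biwheel is an **$R$-biwheel configuration** of $G$ if (i) in $G$, both hubs of $K$ are noncubic and every other vertex of $K$ is cubic; (ii) both ends of $K$ lie in $V(R)$; and (iii) every internal spoke of $K$ is an $R$-thin edge of $G$ of index one. **Theorem ($R$-biwheel Theorem).** Let $G$ be a simple $R$-brick which has no strictly $R$-thin edge, and let $e$ be an $R$-thin edge of $G$ of index one. Then $G$ contains an $R$-biwheel configuration $K$ such that $e$ is an internal spoke of $K$. -/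

import Mathlib

namespace NearBipartite

variable {V : Type*}

/-- The degree of `v` in `G`. -/
noncomputable def deg (G : SimpleGraph V) (v : V) : ℕ := (G.neighborSet v).ncard

/-- `G` has a perfect matching. -/
def HasPerfectMatching (G : SimpleGraph V) : Prop :=
  ∃ M : G.Subgraph, M.IsPerfectMatching

/-- An edge is admissible if some perfect matching contains it. -/
def IsAdmissible (G : SimpleGraph V) (e : Sym2 V) : Prop :=
  ∃ M : G.Subgraph, M.IsPerfectMatching ∧ e ∈ M.edgeSet

/-- A matching covered graph: connected, at least two vertices, every edge admissible. -/
structure IsMatchingCovered (G : SimpleGraph V) : Prop where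
  two_le_card : 2 ≤ Nat.card V
  connected : G.Connected
  admissible : ∀ e ∈ G.edgeSet, IsAdmissible G e

/-- 3-connected: at least four vertices, and connected after the deletion of any set of at most
two vertices. -/
structure IsThreeConnected (G : SimpleGraph V) : Prop where
  four_le_card : 4 ≤ Nat.card V
  connected_compl : ∀ X : Set V, X.ncard ≤ 2 → (G.induce Xᶜ).Connected

/-- A brick: a 3-connected graph such that the deletion of any two distinct vertices leaves a
graph with a perfect matching. -/
structure IsBrick (G : SimpleGraph V) : Prop where
  threeConnected : IsThreeConnected G
  hasPerfectMatching_compl : ∀ u v : V, u ≠ v → HasPerfectMatching (G.induce {u, v}ᶜ)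

/-- A multigraph is a brick if it is loopless and the simple graph obtained by keeping one edge of
each parallel class is a brick: 3-connectedness of a graph on at least four vertices and the
existence of perfect matchings do not depend on edge multiplicities. -/
def IsMultiBrick {α β : Type*} (J : Graph α β) : Prop :=
  J.Loopless ∧ IsBrick J.toSimpleGraph

/-- `R` is a removable doubleton of `G`: a pair of edges such that `G - R` is bipartite and
matching covered. -/
structure IsRemovableDoubleton (G : SimpleGraph V) (R : Set (Sym2 V)) : Prop where
  ncard_eq : R.ncard = 2
  subset_edgeSet : R ⊆ G.edgeSet
  isBipartite : (G.deleteEdges R).IsBipartite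
  isMatchingCovered : IsMatchingCovered (G.deleteEdges R)

/-- An `R`-brick: a brick with the removable doubleton `R`. -/
structure IsRBrick (G : SimpleGraph V) (R : Set (Sym2 V)) : Prop where
  isBrick : IsBrick G
  isRemovableDoubleton : IsRemovableDoubleton G R

/-- The set `V(R)` of ends of the edges of `R`. -/
def ends (R : Set (Sym2 V)) : Set V := {v | ∃ f ∈ R, v ∈ f}

/-- An edge `e` of a matching covered graph `G` is removable if `G - e` is matching covered. -/
def IsRemovable (G : SimpleGraph V) (e : Sym2 V) : Prop :=
  e ∈ G.edgeSet ∧ IsMatchingCovered (G.deleteEdges {e})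

/-- An edge is `R`-compatible if it is removable both in `G` and in `G - R`. -/
def IsRCompatible (G : SimpleGraph V) (R : Set (Sym2 V)) (e : Sym2 V) : Prop :=
  IsRemovable G e ∧ IsRemovable (G.deleteEdges R) e

/-- The edges incident with a vertex of degree two. -/
def edgesAtDegreeTwo (G : SimpleGraph V) : Set (Sym2 V) :=
  {f | f ∈ G.edgeSet ∧ ∃ v ∈ f, deg G v = 2}

/-- The retract of `G`: every vertex of degree two is bicontracted, i.e. every edge incident with
a vertex of degree two is contracted. The result is a multigraph; its vertices are the connected
components of the spanning subgraph formed by the contracted edges, and its edges are the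
remaining edges of `G`. (This agrees with successive bicontraction when no two vertices of degree
two are adjacent, as in the graphs `G - e` with `G` of minimum degree at least three.) -/
def retract (G : SimpleGraph V) :
    Graph (SimpleGraph.fromEdgeSet (edgesAtDegreeTwo G)).ConnectedComponent (Sym2 V) :=
  ((Graph.ofSimpleGraph G).deleteEdges (edgesAtDegreeTwo G)).map
    (SimpleGraph.fromEdgeSet (edgesAtDegreeTwo G)).connectedComponentMk

/-- An edge `e` is `R`-thin if it is `R`-compatible and the retract of `G - e` is a brick. -/
def IsRThin (G : SimpleGraph V) (R : Set (Sym2 V)) (e : Sym2 V) : Prop :=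
  IsRCompatible G R e ∧ IsMultiBrick (retract (G.deleteEdges {e}))

/-- An `R`-thin edge `e` is strictly `R`-thin if the retract of `G - e` is simple. -/
def IsStrictlyRThin (G : SimpleGraph V) (R : Set (Sym2 V)) (e : Sym2 V) : Prop :=
  IsRThin G R e ∧ (retract (G.deleteEdges {e})).Simple

/-- A barrier of `G`: a nonempty set `S` of vertices such that `G - S` has exactly `|S|` odd
components. -/
def IsBarrier (G : SimpleGraph V) (S : Set V) : Prop :=
  S.Nonempty ∧ (G.induce Sᶜ).oddComponents.ncard = S.ncard

/-- The index of `e`: the number of maximal barriers of `G - e` that are nontrivial, i.e. have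
more than one vertex. -/
noncomputable def index (G : SimpleGraph V) (e : Sym2 V) : ℕ :=
  {S : Set V | Maximal (IsBarrier (G.deleteEdges {e})) S ∧ 1 < S.ncard}.ncard

/-- A partial biwheel contained in `H` as a subgraph: an odd path `x 0, …, x (2j+1)` with `j ≥ 1`,
and two further vertices, the hubs `u` and `w`, with `u` joined to the vertices of even index of
the path and `w` joined to those of odd index. -/
structure PartialBiwheel (H : SimpleGraph V) where
  j : ℕ
  one_le_j : 1 ≤ j
  x : Fin (2 * j + 1 + 1) → V
  u : V
  w : V
  x_injective : Function.Injective x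
  u_ne_w : u ≠ w
  x_ne_u : ∀ i, x i ≠ u
  x_ne_w : ∀ i, x i ≠ w
  adj_path : ∀ i : Fin (2 * j + 1), H.Adj (x i.castSucc) (x i.succ)
  adj_u : ∀ i, Even i.val → H.Adj u (x i)
  adj_w : ∀ i, Odd i.val → H.Adj w (x i)

namespace PartialBiwheel

variable {H : SimpleGraph V}

/-- The spoke at the path vertex `x i`. -/
def spoke (K : PartialBiwheel H) (i : Fin (2 * K.j + 1 + 1)) : Sym2 V :=
  if Even i.val then s(K.u, K.x i) else s(K.w, K.x i)

/-- The internal spokes: all spokes except those at the two ends of the path. -/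
def internalSpokes (K : PartialBiwheel H) : Set (Sym2 V) :=
  {f | ∃ i, i ≠ 0 ∧ i ≠ Fin.last _ ∧ f = K.spoke i}

end PartialBiwheel

/-- A partial biwheel `K` in `G - R` is an `R`-biwheel configuration of `G` if, in `G`, its hubs
are noncubic and its other vertices are cubic, both its ends lie in `V(R)`, and each internal
spoke is an `R`-thin edge of index one. -/
structure IsRBiwheelConfiguration (G : SimpleGraph V) (R : Set (Sym2 V))
    (K : PartialBiwheel (G.deleteEdges R)) : Prop where
  deg_u : deg G K.u ≠ 3
  deg_w : deg G K.w ≠ 3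
  deg_x : ∀ i, deg G (K.x i) = 3
  first_mem : K.x 0 ∈ ends R
  last_mem : K.x (Fin.last _) ∈ ends R
  internal : ∀ f ∈ K.internalSpokes, IsRThin G R f ∧ index G f = 1

end NearBipartite

namespace NearBipartite

/-! ### Perfect matchings as involutions -/

variable {V W : Type*}

/-! The edge `e` carries a local structure that propagates along a path until it meets `V(R)`.

Index one forces `e = ab` with exactly one cubic end `a` (`IsRThin.exists_cubic_end`). If neither
end is cubic, `G - e` is its own retract, hence a brick, and has no nontrivial barrier. If both are
cubic, the remaining neighbours of each end form a nontrivial barrier; one barrier containing both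
pairs would meet both colour classes of `H - e`, which is impossible in a bipartite matching covered
graph.

Let `p`, `q` be the other neighbours of `a`. The retract of `G - e` is a brick but not simple, so
`p` and `q` have a second common neighbour `c`, and 3-connectedness makes `c` noncubic
(`IsRThin.exists_fourCycle`). The edge `pc` is a multiple edge of the retract. If `p` were noncubic,
`G - pc` would be a simple brick without vertices of degree two, so `pc` would be strictly `R`-thin
(`IsRThin.deg_eq_three`). Hence `p` and `q` are cubic. If moreover `p` is not in `V(R)`, the retract
of `G - pc` contains that of `G - e` as a spanning subgraph up to multiplicities, so `pc` is again
`R`-thin of index one (`IsRThin.of_fourCycle`).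

Thus the structure at `a` repeats at `p`, with `c` in the role of `b`. Along the path the hubs
alternate between `b` and `c` according to the colour class (`IsInner.step`). Take a longest path of
this kind through `a`. It cannot stop outside `V(R)` unless it closes up to a cycle. That is
impossible: by 3-connectedness the cycle and the two hubs would be all of `G`, and one colour class
would be too small to contain the edge of `R` that lies inside it (`IsRBrick.false_of_closed`). An
even path would have its ends in one colour class, hence joined by an edge of `R`, and would close
up as well. So the path is odd with both ends in `V(R)`, and together with its hubs it is the
required configuration. -/

/-- Some perfect matching of the subgraph of `F` induced by `S`, encoded by the map sending each
vertex to its mate. -/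
def Matchable (F : SimpleGraph V) (S : Set V) : Prop :=
  ∃ m : V → V, ∀ x ∈ S, m x ∈ S ∧ m (m x) = x ∧ F.Adj x (m x)

/-- `m` sends each vertex of `F` to its mate in some perfect matching of `F`. -/
def IsMating (F : SimpleGraph V) (m : V → V) : Prop := ∀ x, m (m x) = x ∧ F.Adj x (m x)

lemma Matchable.mono {F F' : SimpleGraph V} {S : Set V} (h : Matchable F S) (hle : F ≤ F') :
    Matchable F' S := by
  obtain ⟨m, hm⟩ := h
  exact ⟨m, fun x hx ↦ ⟨(hm x hx).1, (hm x hx).2.1, hle (hm x hx).2.2⟩⟩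

lemma IsMating.matchable {F : SimpleGraph V} {m : V → V} (h : IsMating F m) :
    Matchable F Set.univ := ⟨m, fun x _ ↦ ⟨trivial, (h x).1, (h x).2⟩⟩

lemma matchable_univ {F : SimpleGraph V} : Matchable F Set.univ ↔ ∃ m, IsMating F m :=
  ⟨fun ⟨m, hm⟩ ↦ ⟨m, fun x ↦ (hm x trivial).2⟩, fun ⟨_, hm⟩ ↦ hm.matchable⟩

lemma IsMating.injective {F : SimpleGraph V} {m : V → V} (h : IsMating F m) :
    Function.Injective m := fun x y hxy ↦ by rw [← (h x).1, hxy, (h y).1]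

lemma exists_isMating_of_isPerfectMatching {F : SimpleGraph V} {M : F.Subgraph}
    (hM : M.IsPerfectMatching) : ∃ m, IsMating F m ∧ ∀ x y, M.Adj x y ↔ m x = y := by
  rw [SimpleGraph.Subgraph.isPerfectMatching_iff] at hM
  choose m hm hm' using hM
  have key : ∀ x y, M.Adj x y ↔ m x = y :=
    fun x y ↦ ⟨fun h ↦ (hm' x y h).symm, fun h ↦ h ▸ hm x⟩
  exact ⟨m, fun x ↦ ⟨(key _ _).1 (hm x).symm, (hm x).adj_sub⟩, key⟩

lemma exists_isPerfectMatching_of_isMating {F : SimpleGraph V} {m : V → V} (h : IsMating F m) :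
    ∃ M : F.Subgraph, M.IsPerfectMatching ∧ ∀ x y, M.Adj x y ↔ m x = y := by
  refine ⟨⟨Set.univ, fun x y ↦ m x = y, ?_, fun _ ↦ trivial, ⟨?_⟩⟩, ?_, fun _ _ ↦ Iff.rfl⟩
  · rintro x y rfl; exact (h x).2
  · rintro x y rfl; exact (h x).1
  · rw [SimpleGraph.Subgraph.isPerfectMatching_iff]
    exact fun v ↦ ⟨m v, rfl, fun _ hy ↦ Eq.symm hy⟩

lemma hasPerfectMatching_iff {F : SimpleGraph V} :
    HasPerfectMatching F ↔ ∃ m, IsMating F m :=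
  ⟨fun ⟨_, hM⟩ ↦ (exists_isMating_of_isPerfectMatching hM).imp fun _ h ↦ h.1,
    fun ⟨_, hm⟩ ↦ (exists_isPerfectMatching_of_isMating hm).imp fun _ h ↦ h.1⟩

lemma isAdmissible_iff {F : SimpleGraph V} {x y : V} :
    IsAdmissible F s(x, y) ↔ ∃ m, IsMating F m ∧ m x = y := by
  constructor
  · rintro ⟨M, hM, h⟩
    obtain ⟨m, hm, h'⟩ := exists_isMating_of_isPerfectMatching hM
    exact ⟨m, hm, (h' _ _).1 h⟩
  · rintro ⟨m, hm, h⟩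
    obtain ⟨M, hM, h'⟩ := exists_isPerfectMatching_of_isMating hm
    exact ⟨M, hM, (h' _ _).2 h⟩

lemma hasPerfectMatching_induce_iff {F : SimpleGraph V} {S : Set V} :
    HasPerfectMatching (F.induce S) ↔ Matchable F S := by
  classical
  rw [hasPerfectMatching_iff]
  constructor
  · rintro ⟨m, hm⟩
    refine ⟨fun x ↦ if hx : x ∈ S then m ⟨x, hx⟩ else x, fun x hx ↦ ?_⟩
    have h1 := hm ⟨x, hx⟩
    simp [hx, h1.1]
    exact h1.2
  · rintro ⟨m, hm⟩
    refine ⟨fun x ↦ ⟨m x, (hm x x.2).1⟩, fun x ↦ ⟨Subtype.ext (hm x x.2).2.1, (hm x x.2).2.2⟩⟩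

lemma IsMating.matchable_compl {F : SimpleGraph V} {m : V → V} (h : IsMating F m) (x : V) :
    Matchable F {x, m x}ᶜ := by
  refine ⟨m, fun z hz ↦ ⟨?_, h z⟩⟩
  simp only [Set.mem_compl_iff, Set.mem_insert_iff, Set.mem_singleton_iff, not_or] at hz ⊢
  exact ⟨fun h' ↦ hz.2 (by rw [← h', (h z).1]), fun h' ↦ hz.1 (h.injective h')⟩

/-- Matchings of two disjoint sets combine. -/
lemma Matchable.union {F : SimpleGraph V} {S T : Set V} (hS : Matchable F S) (hT : Matchable F T)
    (hd : Disjoint S T) : Matchable F (S ∪ T) := by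
  classical
  obtain ⟨m, hm⟩ := hS
  obtain ⟨n, hn⟩ := hT
  refine ⟨fun x ↦ if x ∈ S then m x else n x, ?_⟩
  rintro x (hx | hx)
  · have := hm x hx
    simp [hx, this.1, this.2.1, this.2.2]
  · have := hn x hx
    have h1 : x ∉ S := hd.notMem_of_mem_right hx
    have h2 : n x ∉ S := hd.notMem_of_mem_right this.1
    simp [h1, h2, this.1, this.2.1, this.2.2]

lemma matchable_pair {F : SimpleGraph V} {x y : V} (h : F.Adj x y) : Matchable F {x, y} := by
  classical
  refine ⟨fun z ↦ if z = x then y else x, ?_⟩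
  rintro z (rfl | rfl)
  · simp [h, h.ne.symm]
  · simp [h.symm, h.ne.symm]

/-- Extend a matching of `S` by an edge. -/
lemma Matchable.add_edge {F : SimpleGraph V} {S T : Set V} {x y : V} (hS : Matchable F S)
    (h : F.Adj x y) (hx : x ∉ S) (hy : y ∉ S) (hT : T = S ∪ {x, y}) : Matchable F T := by
  rw [hT]
  refine hS.union (matchable_pair h) ?_
  rw [Set.disjoint_right]
  rintro z (rfl | rfl) <;> assumption

lemma exists_isMating_of_matchable_compl {F : SimpleGraph V} {x y : V} (hxy : F.Adj x y)
    (h : Matchable F {x, y}ᶜ) : ∃ m, IsMating F m ∧ m x = y := by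
  classical
  obtain ⟨m, hm⟩ := h
  refine ⟨fun z ↦ if z = x then y else if z = y then x else m z, fun z ↦ ?_, by simp⟩
  by_cases hzx : z = x
  · subst hzx; simp [hxy, hxy.ne.symm]
  by_cases hzy : z = y
  · subst hzy; simp [hxy.symm, hxy.ne.symm]
  have := hm z (by simp [hzx, hzy])
  simp only [Set.mem_compl_iff, Set.mem_insert_iff, Set.mem_singleton_iff, not_or] at this
  simp [hzx, hzy, this]

lemma isAdmissible_iff_matchable {F : SimpleGraph V} {x y : V} (h : F.Adj x y) :
    IsAdmissible F s(x, y) ↔ Matchable F {x, y}ᶜ := by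
  rw [isAdmissible_iff]
  constructor
  · rintro ⟨m, hm, rfl⟩; exact hm.matchable_compl x
  · exact exists_isMating_of_matchable_compl h

/-! ### Parity, odd components and barriers -/

lemma even_ncard_of_involution {S : Set V} (hS : S.Finite) {m : V → V}
    (hm : ∀ x ∈ S, m x ∈ S ∧ m (m x) = x ∧ m x ≠ x) : Even S.ncard := by
  classical
  have h := Finset.sum_involution (s := hS.toFinset) (f := fun _ ↦ (1 : ZMod 2))
    (fun x _ ↦ m x) (fun _ _ ↦ by decide)
    (fun x hx _ ↦ (hm x (by simpa using hx)).2.2)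
    (fun x hx ↦ by simpa using (hm x (by simpa using hx)).1)
    (fun x hx ↦ (hm x (by simpa using hx)).2.1)
  rw [Set.ncard_eq_toFinset_card _ hS]
  simp only [Finset.sum_const, nsmul_eq_mul, mul_one] at h
  exact (ZMod.natCast_eq_zero_iff_even).1 h

/-- Odd components of the complement of `S` are at most as many as the vertices of `S` that are
covered by some matching of a set containing the complement of `S`. -/
lemma ncard_oddComponents_le [Finite V] {F : SimpleGraph V} {Q : SimpleGraph W} (φ : Q ↪g F)
    {S T : Set V} (hφ : Set.range φ = Sᶜ) (hTS : T ⊆ S) (h : Matchable F Tᶜ) :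
    Q.oddComponents.ncard ≤ (S \ T).ncard := by
  classical
  obtain ⟨m, hm⟩ := h
  have : Finite W := Finite.of_injective φ φ.injective
  have hT : ∀ z : W, φ z ∈ Tᶜ := fun z hz ↦ by
    have : φ z ∈ Sᶜ := hφ ▸ Set.mem_range_self z
    exact this (hTS hz)
  -- The matching cannot pair up an odd component internally, so it sends some vertex of each one
  -- into `S`; distinct components use distinct vertices of `S`, none of them in `T`.
  have key : ∀ C ∈ Q.oddComponents, ∃ z ∈ C.supp, m (φ z) ∈ S := by
    intro C hC
    by_contra! hcon
    have hodd : Odd C.supp.ncard := hC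
    rw [← Set.ncard_image_of_injective _ φ.injective] at hodd
    refine Nat.not_even_iff_odd.2 hodd (even_ncard_of_involution (Set.toFinite _) (m := m) ?_)
    rintro _ ⟨z, hz, rfl⟩
    have h1 := hm _ (hT z)
    refine ⟨?_, h1.2.1, h1.2.2.ne.symm⟩
    have h2 : m (φ z) ∈ Set.range φ := by rw [hφ]; exact hcon z hz
    obtain ⟨w, hw⟩ := h2
    refine ⟨w, ?_, hw⟩
    have h3 : Q.Adj z w := by rw [← φ.map_adj_iff, hw]; exact h1.2.2
    exact (SimpleGraph.ConnectedComponent.mem_supp_congr_adj C h3).1 hz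
  rcases isEmpty_or_nonempty W with hW | hW
  · rw [Set.eq_empty_of_isEmpty Q.oddComponents, Set.ncard_empty]; exact Nat.zero_le _
  choose! z hz hzS using key
  refine Set.ncard_le_ncard_of_injOn (fun C ↦ m (φ (z C))) ?_ ?_ (Set.toFinite _)
  · exact fun C hC ↦ ⟨hzS C hC, (hm _ (hT _)).1⟩
  · intro C hC D hD hCD
    have h1 : φ (z C) = φ (z D) := by
      rw [← (hm _ (hT (z C))).2.1, ← (hm _ (hT (z D))).2.1]
      exact congrArg m hCD
    have h2 := φ.injective h1
    exact SimpleGraph.ConnectedComponent.eq_of_common_vertex (hz C hC) (h2 ▸ hz D hD)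

lemma ncard_oddComponents_induce_le [Finite V] {F : SimpleGraph V} {S T : Set V} (hTS : T ⊆ S)
    (h : Matchable F Tᶜ) : (F.induce Sᶜ).oddComponents.ncard ≤ (S \ T).ncard :=
  ncard_oddComponents_le (SimpleGraph.Embedding.induce Sᶜ) (by ext; simp) hTS h

/-- Once two vertices of the barrier are removed, only `|S| - 2` remain to absorb a vertex from each
of the `|S|` odd components. -/
lemma IsBarrier.not_matchable [Finite V] {F : SimpleGraph V} {S : Set V} (hS : IsBarrier F S)
    {x y : V} (hx : x ∈ S) (hy : y ∈ S) (hxy : x ≠ y) : ¬ Matchable F {x, y}ᶜ := by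
  intro h
  have hsub : ({x, y} : Set V) ⊆ S := by rintro z (rfl | rfl) <;> assumption
  have h1 := ncard_oddComponents_induce_le hsub h
  rw [hS.2, Set.ncard_sdiff hsub, Set.ncard_pair hxy] at h1
  have : 0 < S.ncard := (Set.ncard_pos).2 hS.1
  omega

/-! ### Connectedness through adjacency-closed sets -/

/-- Closed sets of vertices swallow a connected graph. -/
lemma mem_of_connected {F : SimpleGraph V} {S T : Set V} (h : (F.induce S).Connected) {x : V}
    (hxS : x ∈ S) (hxT : x ∈ T) (hcl : ∀ u ∈ S, u ∈ T → ∀ v ∈ S, F.Adj u v → v ∈ T) : S ⊆ T := by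
  intro y hy
  obtain ⟨p⟩ := h.preconnected ⟨x, hxS⟩ ⟨y, hy⟩
  have : ∀ (u v : S), (F.induce S).Walk u v → u.1 ∈ T → v.1 ∈ T := by
    intro u v p
    induction p with
    | nil => exact id
    | cons hadj _ ih => exact fun hu ↦ ih (hcl _ (Subtype.coe_prop _) hu _ (Subtype.coe_prop _) hadj)
  exact this _ _ p hxT

/-- Converse of `mem_of_connected`, applied to the set of vertices reachable from the root. Together
the two turn connectedness proofs into closure arguments without walks. -/
lemma connected_induce_of_root {F : SimpleGraph V} {S : Set V} {c : V} (hc : c ∈ S)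
    (h : ∀ T : Set V, c ∈ T → (∀ u ∈ S, u ∈ T → ∀ v ∈ S, F.Adj u v → v ∈ T) → S ⊆ T) :
    (F.induce S).Connected := by
  have h1 := h {z | ∀ hz : z ∈ S, (F.induce S).Reachable ⟨c, hc⟩ ⟨z, hz⟩}
    (fun _ ↦ SimpleGraph.Reachable.refl _)
    (fun u hu hu' v hv huv hv' ↦ (hu' hu).trans (SimpleGraph.Adj.reachable huv))
  have : Nonempty S := ⟨⟨c, hc⟩⟩
  refine ⟨fun x y ↦ ?_⟩
  exact ((h1 x.2 x.2).symm).trans (h1 y.2 y.2)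

lemma connected_iff_induce_univ {F : SimpleGraph V} :
    F.Connected ↔ (F.induce Set.univ).Connected :=
  (SimpleGraph.induceUnivIso F).connected_iff.symm

lemma mem_of_connected_univ {F : SimpleGraph V} {T : Set V} (h : F.Connected) {x : V}
    (hxT : x ∈ T) (hcl : ∀ u ∈ T, ∀ v, F.Adj u v → v ∈ T) (y : V) : y ∈ T :=
  mem_of_connected (connected_iff_induce_univ.1 h) (Set.mem_univ x) hxT
    (fun u _ hu v _ huv ↦ hcl u hu v huv) (Set.mem_univ y)

lemma connected_of_root {F : SimpleGraph V} (c : V)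
    (h : ∀ T : Set V, c ∈ T → (∀ u ∈ T, ∀ v, F.Adj u v → v ∈ T) → ∀ y, y ∈ T) :
    F.Connected :=
  connected_iff_induce_univ.2 (connected_induce_of_root (Set.mem_univ c)
    fun T hT hcl y _ ↦ h T hT (fun u hu v huv ↦ hcl u trivial hu v trivial huv) y)

/-- If no perfect matching avoids `x` and `y`, then Tutte's theorem gives an obstruction. -/
lemma matchable_of_connected_compl [Finite V] {F : SimpleGraph V} {a y : V} (hay : a ≠ y)
    (hev : Even (Nat.card V)) (hconn : (F.induce {a, y}ᶜ).Connected)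
    (h : ∀ x, x ≠ a → x ≠ y → Matchable F {x, y}ᶜ) : Matchable F {a, y}ᶜ := by
  classical
  rw [← hasPerfectMatching_induce_iff]
  refine SimpleGraph.tutte.2 fun U hU ↦ ?_
  unfold SimpleGraph.IsTutteViolator at hU
  -- An empty violator means that the connected graph left by deleting `a` and `y` has odd order,
  -- contrary to the parity of `V`.
  rcases U.eq_empty_or_nonempty with rfl | ⟨x, hx⟩
  · rw [SimpleGraph.Subgraph.deleteVerts_empty, Set.ncard_empty] at hU
    set Q := (⊤ : (F.induce ({a, y}ᶜ : Set V)).Subgraph).coe with hQ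
    have hiso : Q ≃g F.induce ({a, y}ᶜ : Set V) := SimpleGraph.Subgraph.topIso
    have hQc : Q.Connected := hiso.connected_iff.2 hconn
    have hsub := hQc.preconnected.subsingleton_connectedComponent
    have h1 : Q.oddComponents.ncard ≤ 1 := Set.ncard_le_one_of_subsingleton _
    have h2 : Odd Q.oddComponents.ncard := by
      rw [show Q.oddComponents.ncard = 1 by omega]; exact odd_one
    rw [SimpleGraph.odd_ncard_oddComponents, Nat.card_congr hiso.toEquiv] at h2
    change Odd (({a, y}ᶜ : Set V)).ncard at h2
    have h3 := Set.ncard_add_ncard_compl ({a, y} : Set V)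
    rw [Set.ncard_pair hay] at h3
    grind
  · have hxa : x.1 ≠ a := fun h ↦ x.2 (by simp [h])
    have hxy : x.1 ≠ y := fun h ↦ x.2 (by simp [h])
    let φ : ((⊤ : (F.induce ({a, y}ᶜ : Set V)).Subgraph).deleteVerts U).coe ↪g F :=
      ⟨⟨fun z ↦ z.1.1, fun z w hzw ↦ Subtype.ext (Subtype.ext hzw)⟩, by
        intro z w
        have hz := z.2
        have hw := w.2
        simp only [SimpleGraph.Subgraph.induce_verts, SimpleGraph.Subgraph.verts_top,
          Set.mem_sdiff, Set.mem_univ, true_and] at hz hw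
        simp only [SimpleGraph.Subgraph.coe_adj, SimpleGraph.Subgraph.induce_adj,
          SimpleGraph.Subgraph.verts_top, SimpleGraph.Subgraph.top_adj, Set.mem_sdiff,
          Set.mem_univ, true_and, hz, hw, not_false_eq_true, SimpleGraph.comap_adj]
        exact Iff.rfl⟩
    -- Any `x ∈ U` may replace `a`: a perfect matching avoiding `x` and `y` bounds the odd
    -- components by `|U|`, since `a` takes the place of `x` in the barrier.
    have h1 := ncard_oddComponents_le φ (S := {a, y} ∪ (Subtype.val '' U)) (T := {x.1, y})
      (by
        ext z
        simp only [Set.mem_range, Set.mem_compl_iff, Set.mem_union, Set.mem_image, not_or]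
        constructor
        · rintro ⟨w, rfl⟩
          refine ⟨w.1.2, ?_⟩
          rintro ⟨t, ht, htw⟩
          have := w.2
          simp only [SimpleGraph.Subgraph.induce_verts, SimpleGraph.Subgraph.verts_top,
            Set.mem_sdiff, Set.mem_univ, true_and] at this
          exact this (Subtype.ext htw ▸ ht)
        · rintro ⟨h1, h2⟩
          exact ⟨⟨⟨z, h1⟩, by simpa using fun h ↦ h2 ⟨⟨z, h1⟩, h, rfl⟩⟩, rfl⟩)
      (by
        rintro z (rfl | rfl)
        · exact Or.inr ⟨x, hx, rfl⟩
        · simp)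
      (h x.1 hxa hxy)
    have h2 : ({a, y} ∪ (Subtype.val '' U)) \ {x.1, y} ⊆ insert a (Subtype.val '' (U \ {x})) := by
      rintro z ⟨(( rfl | rfl) | ⟨w, hw, rfl⟩), hz⟩
      · simp
      · simp at hz
      · refine Or.inr ⟨w, ⟨hw, ?_⟩, rfl⟩
        rintro rfl; simp at hz
    have h3 := Set.ncard_le_ncard h2 (Set.toFinite _)
    have h4 := Set.ncard_insert_le a (Subtype.val '' (U \ {x}))
    rw [Set.ncard_image_of_injective _ Subtype.val_injective] at h4
    have h5 := Set.ncard_sdiff_singleton_add_one hx (Set.toFinite _)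
    omega

/-! ### Bipartite matching covered graphs -/

/-- `A` is a colour class of a proper 2-colouring of `F`. -/
def IsSide (F : SimpleGraph V) (A : Set V) : Prop := ∀ ⦃x y⦄, F.Adj x y → (x ∈ A ↔ y ∉ A)

lemma exists_isSide {F : SimpleGraph V} (hF : F.IsBipartite) (a : V) :
    ∃ A, a ∈ A ∧ IsSide F A := by
  obtain ⟨C⟩ := hF
  refine ⟨{x | C x = C a}, rfl, fun x y hxy ↦ ?_⟩
  have := C.valid hxy
  simp only [Set.mem_ofPred_eq]
  grind

lemma IsSide.compl {F : SimpleGraph V} {A : Set V} (h : IsSide F A) : IsSide F Aᶜ :=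
  fun x y hxy ↦ by have := h hxy; simp only [Set.mem_compl_iff]; tauto

lemma IsSide.anti {F F' : SimpleGraph V} {A : Set V} (h : IsSide F A) (hle : F' ≤ F) :
    IsSide F' A := fun _ _ hxy ↦ h (hle hxy)

lemma IsSide.notMem {F : SimpleGraph V} {A : Set V} (h : IsSide F A) {x y : V} (hx : x ∈ A)
    (hxy : F.Adj x y) : y ∉ A := (h hxy).1 hx

lemma IsSide.mem {F : SimpleGraph V} {A : Set V} (h : IsSide F A) {x y : V} (hx : x ∉ A)
    (hxy : F.Adj x y) : y ∈ A := by have := h hxy; tauto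

lemma IsMating.ncard_eq [Finite V] {F : SimpleGraph V} {A : Set V} (hA : IsSide F A) {m : V → V}
    (hm : IsMating F m) : A.ncard = Aᶜ.ncard := by
  have h1 : m '' A = Aᶜ := by
    ext z
    constructor
    · rintro ⟨x, hx, rfl⟩; exact hA.notMem hx (hm x).2
    · exact fun hz ↦ ⟨m z, hA.mem hz (hm z).2, (hm z).1⟩
  rw [← h1, Set.ncard_image_of_injective _ hm.injective]

/-- A form of Hall's theorem. -/
lemma matchable_of_hall [Finite V] {F : SimpleGraph V} {X Y : Set V} (hd : Disjoint X Y)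
    (hc : X.ncard = Y.ncard)
    (hall : ∀ Z ⊆ X, Z.ncard ≤ {y ∈ Y | ∃ x ∈ Z, F.Adj x y}.ncard) : Matchable F (X ∪ Y) := by
  classical
  have := Fintype.ofFinite V
  have h1 : ∃ f : X → V, Function.Injective f ∧
      ∀ x : X, f x ∈ (Finset.univ.filter fun y ↦ y ∈ Y ∧ F.Adj x y) := by
    rw [← Finset.all_card_le_biUnion_card_iff_exists_injective]
    intro s
    have h2 := hall (Subtype.val '' (s : Set X)) (by rintro _ ⟨x, _, rfl⟩; exact x.2)
    rw [Set.ncard_image_of_injective _ Subtype.val_injective, Set.ncard_coe_finset] at h2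
    refine h2.trans (le_of_eq ?_)
    rw [← Set.ncard_coe_finset]
    congr 1
    ext y
    simp only [Set.mem_ofPred_eq, Finset.coe_biUnion, Set.mem_iUnion, Finset.mem_coe,
      Finset.mem_filter, Finset.mem_univ, true_and, Set.mem_image]
    constructor
    · rintro ⟨hy, _, ⟨x, hx, rfl⟩, hxy⟩; exact ⟨x, hx, hy, hxy⟩
    · rintro ⟨x, hx, hy, hxy⟩; exact ⟨hy, x, ⟨x, hx, rfl⟩, hxy⟩
  obtain ⟨f, hf, hf'⟩ := h1
  simp only [Finset.mem_filter, Finset.mem_univ, true_and] at hf'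
  -- Equal cardinalities make the injection onto, so its inverse supplies mates for `Y`.
  have hsurj : ∀ y ∈ Y, ∃ x, f x = y := by
    have h3 : Set.range f = Y := by
      refine Set.eq_of_subset_of_ncard_le ?_ ?_ (Set.toFinite _)
      · rintro _ ⟨x, rfl⟩; exact (hf' x).1
      · rw [← hc, ← Set.image_univ, Set.ncard_image_of_injective _ hf, Set.ncard_univ]
        exact le_rfl
    intro y hy
    rw [← h3] at hy
    exact hy
  choose g hg using hsurj
  refine ⟨fun z ↦ if hz : z ∈ X then f ⟨z, hz⟩ else if hz : z ∈ Y then g z hz else z, ?_⟩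
  rintro z (hz | hz)
  · have h4 := hf' ⟨z, hz⟩
    have h5 : f ⟨z, hz⟩ ∉ X := hd.notMem_of_mem_right h4.1
    have h6 : g (f ⟨z, hz⟩) h4.1 = ⟨z, hz⟩ := hf (hg _ h4.1)
    simp only [hz, dite_true, h5, dite_false, h4.1, h6]
    exact ⟨Or.inr h4.1, trivial, h4.2⟩
  · have h4 := hg z hz
    have h5 : z ∉ X := hd.notMem_of_mem_right hz
    have h6 := (hf' (g z hz)).2
    rw [h4] at h6
    simp only [h5, hz, dite_true, dite_false, Subtype.coe_prop, Subtype.coe_eta, h4]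
    exact ⟨Or.inl (g z hz).2, trivial, h6.symm⟩

lemma IsMatchingCovered.exists_isMating {F : SimpleGraph V} (h : IsMatchingCovered F) {x y : V}
    (hxy : F.Adj x y) : ∃ m, IsMating F m ∧ m x = y :=
  isAdmissible_iff.1 (h.admissible s(x, y) hxy)

lemma IsMatchingCovered.exists_adj {F : SimpleGraph V} (h : IsMatchingCovered F) (x : V) :
    ∃ y, F.Adj x y := by
  have : Nontrivial V := by
    have := h.two_le_card
    have : Finite V := Nat.finite_of_card_ne_zero (by omega)
    exact Finite.one_lt_card_iff_nontrivial.1 (by omega)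
  exact h.connected.preconnected.exists_adj_of_nontrivial x

lemma IsMatchingCovered.exists_mating {F : SimpleGraph V} (h : IsMatchingCovered F) :
    ∃ m, IsMating F m := by
  obtain ⟨x⟩ := h.connected.nonempty
  obtain ⟨y, hy⟩ := h.exists_adj x
  exact (h.exists_isMating hy).imp fun _ h ↦ h.1

lemma Matchable.ncard_le [Finite V] {m : V → V} {S X N : Set V}
    (hm : ∀ x ∈ S, m (m x) = x) (hX : X ⊆ S) (hN : ∀ x ∈ X, m x ∈ N) :
    X.ncard ≤ N.ncard :=
  Set.ncard_le_ncard_of_injOn m hN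
    (fun x hx y hy hxy ↦ by rw [← hm x (hX hx), ← hm y (hX hy), hxy]) (Set.toFinite _)

lemma sdiff_union_compl_sdiff {A : Set V} {x y : V} (hx : x ∈ A) (hy : y ∉ A) :
    A \ {x} ∪ Aᶜ \ {y} = {x, y}ᶜ := by
  ext z
  simp only [Set.mem_union, Set.mem_sdiff, Set.mem_singleton_iff, Set.mem_compl_iff,
    Set.mem_insert_iff, not_or]
  by_cases hz : z ∈ A
  · have : z ≠ y := by rintro rfl; exact hy hz
    tauto
  · have : z ≠ x := by rintro rfl; exact hz hx
    tauto

/-- Deleting one vertex from each colour class of a bipartite matching covered graph leaves a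
graph with a perfect matching. -/
lemma IsMatchingCovered.matchable_of_isSide [Finite V] {F : SimpleGraph V}
    (h : IsMatchingCovered F) {A : Set V} (hA : IsSide F A) {x y : V} (hx : x ∈ A) (hy : y ∉ A) :
    Matchable F {x, y}ᶜ := by
  rw [← sdiff_union_compl_sdiff hx hy]
  obtain ⟨m₀, hm₀⟩ := h.exists_mating
  have hcard := hm₀.ncard_eq hA
  refine matchable_of_hall ?_ ?_ fun X hX ↦ ?_
  · exact (disjoint_compl_right).mono Set.sdiff_subset Set.sdiff_subset
  · rw [Set.ncard_sdiff_singleton_of_mem hx, Set.ncard_sdiff_singleton_of_mem (by exact hy), hcard]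
  by_contra! hlt
  set N := {z ∈ Aᶜ \ {y} | ∃ x ∈ X, F.Adj x z}
  set NX := {z | ∃ x ∈ X, F.Adj x z}
  have h1 : NX.ncard ≤ X.ncard := by
    have h2 : NX ⊆ insert y N := by
      rintro z ⟨w, hw, hwz⟩
      by_cases hzy : z = y
      · exact Or.inl hzy
      · exact Or.inr ⟨⟨hA.notMem (hX hw).1 hwz, hzy⟩, w, hw, hwz⟩
    have h3 := Set.ncard_le_ncard h2 (Set.toFinite _)
    have h4 := Set.ncard_insert_le y N
    omega
  obtain ⟨x₀, hx₀⟩ : X.Nonempty := (Set.ncard_pos).1 (by omega)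
  -- A failure of Hall's condition leaves `|NX| ≤ |X|`, so every perfect matching maps `X` onto its
  -- full neighbourhood. As every edge is admissible, `X ∪ NX` is then closed under adjacency, yet
  -- it misses `x`.
  have h5 : ∀ m, IsMating F m → m '' X = NX := by
    intro m hm
    refine Set.eq_of_subset_of_ncard_le ?_ ?_ (Set.toFinite _)
    · rintro _ ⟨w, hw, rfl⟩; exact ⟨w, hw, (hm w).2⟩
    · rwa [Set.ncard_image_of_injective _ hm.injective]
  have h6 := mem_of_connected_univ h.connected (T := X ∪ NX) (Or.inl hx₀) ?_ x
  · rcases h6 with h6 | ⟨w, hw, hwx⟩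
    · exact (hX h6).2 rfl
    · exact hA.notMem (hX hw).1 hwx hx
  · rintro u (hu | hu) v huv
    · exact Or.inr ⟨u, hu, huv⟩
    · obtain ⟨m, hm, hmuv⟩ := h.exists_isMating huv
      rw [← h5 m hm] at hu
      obtain ⟨w, hw, rfl⟩ := hu
      rw [(hm w).1] at hmuv
      exact Or.inl (hmuv ▸ hw)

/-! ### Switching along a 4-cycle and removable edges -/

/-- Switch a perfect matching along the 4-cycle `a p c q`. -/
lemma IsMating.switch {F : SimpleGraph V} {m : V → V} (hm : IsMating F m) {a p c q : V}
    (hap : F.Adj a p) (hcq : F.Adj c q) (hac : a ≠ c) (hpq : p ≠ q) (hmc : m p = c)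
    (hma : m a = q) :
    ∃ m', IsMating F m' ∧ m' a = p ∧ m' c = q ∧
      ∀ z, z ≠ a → z ≠ p → z ≠ c → z ≠ q → m' z = m z := by
  classical
  have hmp : m c = p := by rw [← hmc, (hm p).1]
  have hmq : m q = a := by rw [← hma, (hm a).1]
  have haq : a ≠ q := by rintro rfl; exact (hm a).2.ne hma.symm
  have hpc : p ≠ c := by rintro rfl; exact (hm p).2.ne hmc.symm
  have h1 := hap.ne
  have h2 := hcq.ne
  refine ⟨fun z ↦ if z = a then p else if z = p then a else if z = c then q else
    if z = q then c else m z, fun z ↦ ?_, by simp, by simp [hac.symm, hpc.symm], ?_⟩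
  · by_cases hza : z = a
    · subst hza; simp [hap, h1.symm]
    by_cases hzp : z = p
    · subst hzp; simp [hap.symm, h1.symm]
    by_cases hzc : z = c
    · subst hzc; simp [hcq, hza, hzp, h2.symm, haq.symm, hpq.symm]
    by_cases hzq : z = q
    · subst hzq; simp [hcq.symm, hza, hzp, hac.symm, hpc.symm, hzc]
    have h3 : m z ≠ a := fun h ↦ hzq (by rw [← hma, ← h, (hm z).1])
    have h4 : m z ≠ p := fun h ↦ hzc (by rw [← hmc, ← h, (hm z).1])
    have h5 : m z ≠ c := fun h ↦ hzp (by rw [← hmp, ← h, (hm z).1])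
    have h6 : m z ≠ q := fun h ↦ hza (by rw [← hmq, ← h, (hm z).1])
    simp [hza, hzp, hzc, hzq, h3, h4, h5, h6, hm z]
  · intro z h1 h2 h3 h4
    simp [h1, h2, h3, h4]

lemma deleteEdges_singleton_adj {F : SimpleGraph V} {x y u v : V} :
    (F.deleteEdges {s(x, y)}).Adj u v ↔
      F.Adj u v ∧ ¬ (u = x ∧ v = y) ∧ ¬ (u = y ∧ v = x) := by
  simp [SimpleGraph.deleteEdges_adj]

lemma IsMating.deleteEdges {F : SimpleGraph V} {m : V → V} (hm : IsMating F m) {x y : V}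
    (hxy : m x ≠ y) : IsMating (F.deleteEdges {s(x, y)}) m := by
  refine fun z ↦ ⟨(hm z).1, deleteEdges_singleton_adj.2 ⟨(hm z).2, ?_, ?_⟩⟩
  · rintro ⟨rfl, h⟩; exact hxy h
  · rintro ⟨rfl, h⟩; exact hxy (by rw [← h, (hm z).1])

/-- If `a` has exactly the neighbours `p` and `q`, both adjacent to `c`, then an edge other than
`pc` and `aq` remains admissible when `pc` is deleted. -/
lemma IsMating.exists_avoiding {F : SimpleGraph V} {m : V → V} (hm : IsMating F m) {a p c q : V}
    (hN : ∀ z, F.Adj a z ↔ z = p ∨ z = q) (hcq : F.Adj c q) (hac : a ≠ c) (hpq : p ≠ q)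
    {x y : V} (hxy : m x = y) (h1 : s(x, y) ≠ s(p, c)) (h2 : s(x, y) ≠ s(a, q)) :
    ∃ m', IsMating (F.deleteEdges {s(p, c)}) m' ∧ m' x = y := by
  by_cases hmp : m p = c
  swap
  · exact ⟨m, hm.deleteEdges hmp, hxy⟩
  -- Since `p` is matched to `c`, only `q` is left for `a`; the switch trades `pc`, `aq` for `ap`,
  -- `cq` and keeps all other edges.
  have hma : m a = q := by
    rcases (hN _).1 (hm a).2 with h | h
    · exact absurd (by rw [← hmp, ← h, (hm a).1]) hac
    · exact h
  obtain ⟨m', hm', h3, h4, h5⟩ := hm.switch ((hN p).2 (Or.inl rfl)) hcq hac hpq hmp hma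
  have h6 : m' p = a := by rw [← h3, (hm' a).1]
  refine ⟨m', hm'.deleteEdges (by rw [h6]; exact hac), ?_⟩
  rw [h5, hxy]
  · rintro rfl; exact h2 (by rw [← hxy, hma])
  · rintro rfl; exact h1 (by rw [← hxy, hmp])
  · rintro rfl; exact h1 (by rw [← hxy, Sym2.eq_swap, ← hmp, (hm p).1])
  · rintro rfl; exact h2 (by rw [← hxy, Sym2.eq_swap, ← hma, (hm a).1])

/-- The path `p a q c` replaces the deleted edge. -/
lemma connected_deleteEdges_of_fourCycle {F : SimpleGraph V} (hF : F.Connected) {a p c q : V}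
    (hap : F.Adj a p) (haq : F.Adj a q) (hcq : F.Adj c q) (hac : a ≠ c) (hpq : p ≠ q) :
    (F.deleteEdges {s(p, c)}).Connected := by
  have hadj : ∀ u v, F.Adj u v → ¬ (u = p ∧ v = c) → ¬ (u = c ∧ v = p) →
      (F.deleteEdges {s(p, c)}).Adj u v :=
    fun u v h h1 h2 ↦ deleteEdges_singleton_adj.2 ⟨h, h1, h2⟩
  have e1 := hadj p a hap.symm (by tauto) (by grind [hap.ne])
  have e2 := hadj a q haq (by grind [hap.ne]) (by tauto)
  have e3 := hadj q c hcq.symm (by grind) (by grind)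
  refine connected_of_root p fun T hpT hcl ↦ ?_
  refine mem_of_connected_univ hF hpT fun u hu v huv ↦ ?_
  by_cases h1 : u = p ∧ v = c
  · obtain ⟨rfl, rfl⟩ := h1
    exact hcl _ (hcl _ (hcl _ hu _ e1) _ e2) _ e3
  by_cases h2 : u = c ∧ v = p
  · rw [h2.2]; exact hpT
  exact hcl u hu v (hadj u v huv h1 h2)

/-- In a bipartite matching covered graph `F` with a removable edge `ab`, where `a` is cubic, an
edge `pc` of a 4-cycle `a p c q` is removable if `p` is not of degree two. -/
lemma IsMatchingCovered.deleteEdges_of_fourCycle [Finite V] {F : SimpleGraph V}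
    (hF : IsMatchingCovered F) {A : Set V} (hA : IsSide F A) {a b p q c d : V} (haA : a ∈ A)
    (hFe : IsMatchingCovered (F.deleteEdges {s(a, b)}))
    (hN : ∀ z, F.Adj a z ↔ z = b ∨ z = p ∨ z = q) (hbp : b ≠ p) (hbq : b ≠ q) (hpq : p ≠ q)
    (hac : a ≠ c) (hpc : F.Adj p c) (hcq : F.Adj c q) (hda : d ≠ a) (hdc : d ≠ c)
    (hpd : F.Adj p d) : IsMatchingCovered (F.deleteEdges {s(p, c)}) := by
  have hab : F.Adj a b := (hN b).2 (Or.inl rfl)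
  have hap : F.Adj a p := (hN p).2 (Or.inr (Or.inl rfl))
  have haq : F.Adj a q := (hN q).2 (Or.inr (Or.inr rfl))
  have hNe : ∀ z, (F.deleteEdges {s(a, b)}).Adj a z ↔ z = p ∨ z = q := by
    intro z
    rw [deleteEdges_singleton_adj, hN]
    have := hab.ne
    grind
  have hbA := hA.notMem haA hab
  have hpA := hA.notMem haA hap
  have hqA := hA.notMem haA haq
  have hcA := hA.mem hpA hpc
  have hdA := hA.mem hpA hpd
  have hcqe : (F.deleteEdges {s(a, b)}).Adj c q := by
    rw [deleteEdges_singleton_adj]; exact ⟨hcq, by tauto, by grind⟩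
  have hpde : (F.deleteEdges {s(a, b)}).Adj p d := by
    rw [deleteEdges_singleton_adj]; exact ⟨hpd, by grind, by grind⟩
  have hle : (F.deleteEdges {s(a, b)}).deleteEdges {s(p, c)} ≤ F.deleteEdges {s(p, c)} :=
    SimpleGraph.deleteEdges_mono (SimpleGraph.deleteEdges_le _)
  refine ⟨hF.two_le_card, connected_deleteEdges_of_fourCycle hF.connected hap haq hcq hac hpq, ?_⟩
  rintro g hg
  induction g with | h x y => ?_
  have hg' : (F.deleteEdges {s(p, c)}).Adj x y := hg
  have hxy := (deleteEdges_singleton_adj.1 hg').1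
  have hne : s(x, y) ≠ s(p, c) := by
    intro h
    rw [SimpleGraph.mem_edgeSet, SimpleGraph.deleteEdges_adj] at hg
    exact hg.2 h
  -- The edge `ab` is missing from `F - ab`, so matchings of that graph say nothing directly about
  -- it; its admissibility is checked by Hall's condition.
  by_cases hge : s(x, y) = s(a, b)
  · rw [hge]
    have hab' : (F.deleteEdges {s(p, c)}).Adj a b := by
      rw [← SimpleGraph.mem_edgeSet, ← hge]; exact hg
    rw [isAdmissible_iff_matchable hab', ← sdiff_union_compl_sdiff haA hbA]
    obtain ⟨m₀, hm₀⟩ := hF.exists_mating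
    have hcard := hm₀.ncard_eq hA
    have hcard' : (A \ {a}).ncard = (Aᶜ \ {b}).ncard := by
      rw [Set.ncard_sdiff_singleton_of_mem haA, Set.ncard_sdiff_singleton_of_mem (by exact hbA),
        hcard]
    refine matchable_of_hall ?_ hcard' fun X hX ↦ ?_
    · exact (disjoint_compl_right).mono Set.sdiff_subset Set.sdiff_subset
    set N := {z ∈ Aᶜ \ {b} | ∃ x ∈ X, (F.deleteEdges {s(p, c)}).Adj x z}
    by_cases hcX : c ∈ X
    swap
    · obtain ⟨m, hm⟩ := (isAdmissible_iff_matchable hab).1 (hF.admissible _ hab)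
      have hXS : X ⊆ {a, b}ᶜ := by
        rintro z hz (rfl | rfl)
        · exact (hX hz).2 rfl
        · exact hbA (hX hz).1
      refine Matchable.ncard_le (fun x hx ↦ (hm x hx).2.1) hXS fun x hx ↦ ?_
      have h1 := hm x (hXS hx)
      simp only [Set.mem_compl_iff, Set.mem_insert_iff, Set.mem_singleton_iff, not_or] at h1
      refine ⟨⟨hA.notMem (hX hx).1 h1.2.2, h1.1.2⟩, x, hx, ?_⟩
      rw [deleteEdges_singleton_adj]
      refine ⟨h1.2.2, ?_, ?_⟩
      · rintro ⟨rfl, -⟩; exact hpA (hX hx).1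
      · rintro ⟨rfl, -⟩; exact hcX hx
    have hqN : q ∈ N := by
      refine ⟨⟨hqA, hbq.symm⟩, c, hcX, ?_⟩
      rw [deleteEdges_singleton_adj]
      exact ⟨hcq, by rintro ⟨rfl, -⟩; exact hpA hcA, by rintro ⟨-, rfl⟩; exact hpq rfl⟩
    by_cases hex : ∃ x ∈ A, x ∉ X ∧ x ≠ a
    -- Deleting `x` and `b` from `F - ab` leaves a perfect matching. Applied to `X ∪ {a}` it gives
    -- `|X| + 1 ≤ |N ∪ {p}|`, because `p` and `q` are the only neighbours of `a` there and `q`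
    -- already lies in `N`.
    · obtain ⟨x, hxA, hxX, hxa⟩ := hex
      obtain ⟨m, hm⟩ := hFe.matchable_of_isSide (hA.anti (SimpleGraph.deleteEdges_le _)) hxA hbA
      have hXS : insert a X ⊆ {x, b}ᶜ := by
        rintro z (rfl | hz) (rfl | rfl)
        · exact hxa rfl
        · exact hbA haA
        · exact hxX hz
        · exact hbA (hX hz).1
      have h1 : (insert a X).ncard ≤ (insert p N).ncard := by
        refine Matchable.ncard_le (fun x hx ↦ (hm x hx).2.1) hXS fun x hx ↦ ?_
        have h1 := hm x (hXS hx)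
        simp only [Set.mem_compl_iff, Set.mem_insert_iff, Set.mem_singleton_iff, not_or] at h1
        rcases hx with rfl | hx
        · rcases (hNe _).1 h1.2.2 with h | h
          · exact Or.inl h
          · exact Or.inr (h ▸ hqN)
        by_cases hmp : m x = p
        · exact Or.inl hmp
        have h2 := (deleteEdges_singleton_adj.1 h1.2.2).1
        refine Or.inr ⟨⟨hA.notMem (hX hx).1 h2, h1.1.2⟩, x, hx, ?_⟩
        rw [deleteEdges_singleton_adj]
        refine ⟨h2, ?_, ?_⟩
        · rintro ⟨rfl, -⟩; exact hpA (hX hx).1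
        · rintro ⟨-, h⟩; exact hmp h
      rw [Set.ncard_insert_of_notMem (fun h ↦ (hX h).2 rfl)] at h1
      have := Set.ncard_insert_le p N
      omega
    · push Not at hex
      have hXA : X = A \ {a} := by
        refine hX.antisymm fun z hz ↦ ?_
        by_contra hzX
        exact hz.2 (hex z hz.1 hzX)
      rw [hXA, hcard']
      refine Set.ncard_le_ncard (fun y hy ↦ ?_) (Set.toFinite _)
      refine ⟨hy, ?_⟩
      have hyc : y ≠ c := by rintro rfl; exact hy.1 hcA
      by_cases hyp : y = p
      · subst hyp
        exact ⟨d, hXA ▸ ⟨hdA, hda⟩, deleteEdges_singleton_adj.2 ⟨hpd.symm, by grind, by tauto⟩⟩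
      obtain ⟨z, hyz⟩ : ∃ z, F.Adj y z := ⟨_, (hm₀ y).2⟩
      by_cases hza : z = a
      · subst hza
        rcases (hN y).1 hyz.symm with h | h | h
        · exact absurd h hy.2
        · exact absurd h hyp
        · rw [h]; exact hqN.2
      · exact ⟨z, hXA ▸ ⟨hA.mem hy.1 hyz, hza⟩,
          deleteEdges_singleton_adj.2 ⟨hyz.symm, by tauto, by tauto⟩⟩
  rw [isAdmissible_iff]
  -- The switch would destroy `aq`. A perfect matching of `F - ab` through `pd` instead avoids `pc`
  -- and forces `a` onto `q`.
  by_cases hgq : s(x, y) = s(a, q)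
  · obtain ⟨m, hm, hmp⟩ := hFe.exists_isMating hpde
    have hma : m a = q := by
      rcases (hNe _).1 (hm a).2 with h | h
      · exact absurd (by rw [← hmp, ← h, (hm a).1]) hda
      · exact h
    have hm' := hm.deleteEdges (x := p) (y := c) (by rw [hmp]; exact hdc)
    refine ⟨m, fun z ↦ ⟨(hm' z).1, hle (hm' z).2⟩, ?_⟩
    rcases Sym2.eq_iff.1 hgq with ⟨rfl, rfl⟩ | ⟨rfl, rfl⟩
    · exact hma
    · rw [← hma, (hm _).1]
  · have hxye : (F.deleteEdges {s(a, b)}).Adj x y := by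
      rw [SimpleGraph.deleteEdges_adj]; exact ⟨hxy, hge⟩
    obtain ⟨m, hm, hmx⟩ := hFe.exists_isMating hxye
    obtain ⟨m', hm', h⟩ := hm.exists_avoiding hNe hcqe hac hpq hmx hne hgq
    exact ⟨m', fun z ↦ ⟨(hm' z).1, hle (hm' z).2⟩, h⟩

/-! ### Bricks and small degrees -/

/-- Adjacency need only be preserved in one direction, since additional edges keep a graph a brick.
This allows a comparison of retracts without computing all their edges. -/
lemma IsBrick.of_equiv {W' : Type*} {K : SimpleGraph W} {K' : SimpleGraph W'} (hK : IsBrick K)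
    (φ : W ≃ W') (h : ∀ x y, K.Adj x y → K'.Adj (φ x) (φ y)) : IsBrick K' := by
  refine ⟨⟨?_, fun X hX ↦ ?_⟩, fun u v huv ↦ ?_⟩
  · rw [← Nat.card_congr φ]; exact hK.threeConnected.four_le_card
  · have h1 := hK.threeConnected.connected_compl (φ.symm '' X)
      (by rwa [Set.ncard_image_of_injective _ φ.symm.injective])
    have hmem : ∀ x, x ∈ (φ.symm '' X)ᶜ ↔ φ x ∈ Xᶜ := by
      intro x
      simp only [Set.mem_compl_iff, Set.mem_image]
      constructor
      · exact fun h h' ↦ h ⟨_, h', by simp⟩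
      · rintro h ⟨y, hy, rfl⟩; exact h (by simpa using hy)
    obtain ⟨c, hc⟩ := h1.nonempty
    refine connected_induce_of_root ((hmem c).1 hc) fun T hcT hcl y hy ↦ ?_
    have h2 := mem_of_connected h1 hc (T := φ ⁻¹' T) hcT fun u hu hu' v hv huv ↦
      hcl _ ((hmem u).1 hu) hu' _ ((hmem v).1 hv) (h u v huv)
    have h3 : φ.symm y ∈ (φ.symm '' X)ᶜ := (hmem _).2 (by simpa using hy)
    simpa using h2 h3
  · rw [hasPerfectMatching_induce_iff]
    obtain ⟨m, hm⟩ := hasPerfectMatching_induce_iff.1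
      (hK.hasPerfectMatching_compl (φ.symm u) (φ.symm v) (φ.symm.injective.ne huv))
    have hmem : ∀ x, x ∈ ({φ.symm u, φ.symm v}ᶜ : Set W) ↔ φ x ∈ ({u, v}ᶜ : Set W') := by
      intro x
      simp [Equiv.eq_symm_apply]
    refine ⟨fun x ↦ φ (m (φ.symm x)), fun x hx ↦ ?_⟩
    have h1 := hm (φ.symm x) ((hmem _).2 (by simpa using hx))
    refine ⟨(hmem _).1 h1.1, by simp [h1.2.1], ?_⟩
    simpa using h _ _ h1.2.2

lemma IsBrick.matchable {F : SimpleGraph V} (h : IsBrick F) {u v : V} (huv : u ≠ v) :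
    Matchable F {u, v}ᶜ := hasPerfectMatching_induce_iff.1 (h.hasPerfectMatching_compl u v huv)

lemma deg_eq_three_iff {F : SimpleGraph V} {v : V} : deg F v = 3 ↔
    ∃ x y z, x ≠ y ∧ x ≠ z ∧ y ≠ z ∧ ∀ w, F.Adj v w ↔ w = x ∨ w = y ∨ w = z := by
  rw [deg, Set.ncard_eq_three]
  simp only [Set.ext_iff, SimpleGraph.mem_neighborSet, Set.mem_insert_iff, Set.mem_singleton_iff]

lemma deg_eq_two_iff {F : SimpleGraph V} {v : V} : deg F v = 2 ↔
    ∃ x y, x ≠ y ∧ ∀ w, F.Adj v w ↔ w = x ∨ w = y := by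
  rw [deg, Set.ncard_eq_two]
  simp only [Set.ext_iff, SimpleGraph.mem_neighborSet, Set.mem_insert_iff, Set.mem_singleton_iff]

/-- A vertex of degree greater than `k` has a neighbour outside any set of `k` vertices. -/
lemma exists_adj_notMem [Finite V] {F : SimpleGraph V} {v : V} {S : Set V}
    (h : S.ncard < deg F v) : ∃ z, F.Adj v z ∧ z ∉ S := by
  by_contra! hcon
  exact absurd (Set.ncard_le_ncard (s := F.neighborSet v) (t := S) hcon (Set.toFinite _))
    (not_le.2 h)

/-- Deleting at most two neighbours of `v` isolates it, so connectedness would leave no other vertex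
and at most three in total. -/
lemma IsBrick.three_le_deg [Finite V] {F : SimpleGraph V} (h : IsBrick F) (v : V) :
    3 ≤ deg F v := by
  by_contra! hlt
  have h1 := h.threeConnected.connected_compl (F.neighborSet v) (by unfold deg at hlt; omega)
  have h2 := mem_of_connected h1 (x := v) (T := {v}) (by simp) rfl (by
    rintro u _ rfl w hw huw
    exact absurd huw hw)
  have h3 : (Set.univ : Set V) ⊆ insert v (F.neighborSet v) := by
    intro z _
    by_cases hz : z ∈ F.neighborSet v
    · exact Or.inr hz
    · exact Or.inl (h2 hz)
  have h4 := Set.ncard_le_ncard h3 (Set.toFinite _)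
  have h5 := Set.ncard_insert_le v (F.neighborSet v)
  have h6 := h.threeConnected.four_le_card
  rw [Set.ncard_univ] at h4
  unfold deg at hlt
  omega

/-! ### Contraction at a vertex of degree two -/

/-- The simple graph obtained from `F` by identifying `a`, `p` and `q`; the new vertex is
called `q`. It is meant for a vertex `a` whose only neighbours are `p` and `q`. -/
def contract (F : SimpleGraph V) (a p q : V) : SimpleGraph {x : V // x ≠ a ∧ x ≠ p} where
  Adj x y := x ≠ y ∧ (F.Adj x y ∨ (x.1 = q ∧ F.Adj p y) ∨ (y.1 = q ∧ F.Adj x p))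
  symm := ⟨by
    rintro x y ⟨h, h'⟩
    refine ⟨h.symm, ?_⟩
    rcases h' with h' | ⟨h1, h2⟩ | ⟨h1, h2⟩
    · exact Or.inl h'.symm
    · exact Or.inr (Or.inr ⟨h1, h2.symm⟩)
    · exact Or.inr (Or.inl ⟨h1, h2.symm⟩)⟩

section contract

variable {F : SimpleGraph V} {a p q : V}

lemma contract_adj {x y : {x : V // x ≠ a ∧ x ≠ p}} : (contract F a p q).Adj x y ↔
    x ≠ y ∧ (F.Adj x y ∨ (x.1 = q ∧ F.Adj p y) ∨ (y.1 = q ∧ F.Adj x p)) := Iff.rfl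

/-- In the contraction only the merged vertex and `Y` are deleted, at most two vertices. -/
lemma IsBrick.connected_of_contract [Finite V] (hK : IsBrick (contract F a p q)) (Y : Set V)
    (hY : Y.ncard ≤ 1) : (F.induce ({a, p, q} ∪ Y)ᶜ).Connected := by
  set X : Set {x : V // x ≠ a ∧ x ≠ p} := {x | x.1 = q ∨ x.1 ∈ Y}
  have hX : X.ncard ≤ 2 := by
    rw [← Set.ncard_image_of_injective X Subtype.val_injective]
    have h1 : Subtype.val '' X ⊆ insert q Y := by
      rintro _ ⟨x, hx | hx, rfl⟩
      · exact Or.inl hx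
      · exact Or.inr hx
    have h2 := Set.ncard_le_ncard h1 (Set.toFinite _)
    have h3 := Set.ncard_insert_le q Y
    omega
  have h1 := hK.threeConnected.connected_compl X hX
  have hmem : ∀ x : {x : V // x ≠ a ∧ x ≠ p}, x ∈ Xᶜ ↔ x.1 ∈ ({a, p, q} ∪ Y)ᶜ := by
    intro x
    have := x.2
    simp only [X, Set.mem_compl_iff, Set.mem_ofPred_eq, Set.mem_union, Set.mem_insert_iff,
      Set.mem_singleton_iff]
    tauto
  obtain ⟨c, hc⟩ := h1.nonempty
  refine connected_induce_of_root ((hmem c).1 hc) fun T hcT hcl y hy ↦ ?_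
  have h2 := mem_of_connected h1 hc (T := Subtype.val ⁻¹' T) hcT fun u hu hu' v hv huv ↦ by
    refine hcl _ ((hmem u).1 hu) hu' _ ((hmem v).1 hv) ?_
    rcases huv.2 with h | h | h
    · exact h
    · exact absurd (Or.inl h.1) hu
    · exact absurd (Or.inl h.1) hv
  have hy' : y ≠ a ∧ y ≠ p := by
    simp only [Set.mem_compl_iff, Set.mem_union, Set.mem_insert_iff, Set.mem_singleton_iff] at hy
    tauto
  exact h2 ((hmem ⟨y, hy'⟩).2 hy)

lemma Matchable.of_contract {S : Set {x : V // x ≠ a ∧ x ≠ p}}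
    (h : Matchable (contract F a p q) S) (hq : ∀ x ∈ S, x.1 ≠ q) :
    Matchable F (Subtype.val '' S) := by
  classical
  obtain ⟨m, hm⟩ := h
  refine ⟨fun x ↦ if hx : x ≠ a ∧ x ≠ p then (m ⟨x, hx⟩).1 else x, ?_⟩
  rintro _ ⟨x, hx, rfl⟩
  have h1 := hm x hx
  have h2 := x.2
  have h3 := (m x).2
  simp only [h2, ne_eq, not_false_eq_true, and_self, dite_true, h3, Subtype.coe_eta, h1.2.1]
  refine ⟨⟨_, h1.1, rfl⟩, trivial, ?_⟩
  rcases h1.2.2.2 with h | h | h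
  · exact h
  · exact absurd h.1 (hq x hx)
  · exact absurd h.1 (hq _ h1.1)

lemma IsBrick.matchable_compl_four (hK : IsBrick (contract F a p q)) (hqa : q ≠ a)
    (hqp : q ≠ p) {y : V} (hya : y ≠ a) (hyp : y ≠ p) (hyq : y ≠ q) :
    Matchable F {a, p, q, y}ᶜ := by
  have h1 := hK.matchable (u := ⟨q, hqa, hqp⟩) (v := ⟨y, hya, hyp⟩)
    (fun h ↦ hyq (congrArg Subtype.val h).symm)
  have h2 := h1.of_contract (fun x hx hxq ↦ hx (Or.inl (Subtype.ext hxq)))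
  convert h2
  ext z
  simp only [Set.mem_compl_iff, Set.mem_insert_iff, Set.mem_singleton_iff, Set.mem_image]
  constructor
  · intro hz
    exact ⟨⟨z, by tauto, by tauto⟩, by simp only [Subtype.mk.injEq]; tauto, rfl⟩
  · rintro ⟨w, hw, rfl⟩
    have := w.2
    simp only [Subtype.ext_iff] at hw
    tauto

/-- Matchings of the contraction lift: the edge at the merged vertex comes from `p` or from `q`, and
`a` is matched to the other one. The pair `p`, `q` is excluded because its deletion isolates `a`. -/
lemma IsBrick.matchable_of_contract (hK : IsBrick (contract F a p q)) (hap : F.Adj a p)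
    (haq : F.Adj a q) (hpq : p ≠ q) {x y : V} (hxa : x ≠ a) (hya : y ≠ a) (hxy : x ≠ y)
    (h1 : ¬ (x = p ∧ y = q)) (h2 : ¬ (x = q ∧ y = p)) : Matchable F {x, y}ᶜ := by
  have hpa := hap.ne
  have hqa := haq.ne
  have key := fun z (hza : z ≠ a) (hzp : z ≠ p) (hzq : z ≠ q) ↦
    hK.matchable_compl_four hqa.symm hpq.symm hza hzp hzq
  by_cases hxp : x = p
  · subst hxp
    refine (key y hya hxy.symm (by tauto)).add_edge haq (by simp) (by simp) ?_
    ext z; simp only [Set.mem_compl_iff, Set.mem_insert_iff, Set.mem_singleton_iff, Set.mem_union]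
    grind
  by_cases hxq : x = q
  · subst hxq
    refine (key y hya (by tauto) hxy.symm).add_edge hap (by simp) (by simp) ?_
    ext z; simp only [Set.mem_compl_iff, Set.mem_insert_iff, Set.mem_singleton_iff, Set.mem_union]
    grind
  by_cases hyp : y = p
  · subst hyp
    refine (key x hxa hxp hxq).add_edge haq (by simp) (by simp) ?_
    ext z; simp only [Set.mem_compl_iff, Set.mem_insert_iff, Set.mem_singleton_iff, Set.mem_union]
    grind
  by_cases hyq : y = q
  · subst hyq
    refine (key x hxa hxp hxq).add_edge hap (by simp) (by simp) ?_
    ext z; simp only [Set.mem_compl_iff, Set.mem_insert_iff, Set.mem_singleton_iff, Set.mem_union]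
    grind
  obtain ⟨m, hm⟩ := hK.matchable (u := ⟨x, hxa, hxp⟩) (v := ⟨y, hya, hyp⟩)
    (fun h ↦ hxy (congrArg Subtype.val h))
  set Q : {x : V // x ≠ a ∧ x ≠ p} := ⟨q, hqa.symm, hpq.symm⟩
  set S : Set {x : V // x ≠ a ∧ x ≠ p} := {⟨x, hxa, hxp⟩, ⟨y, hya, hyp⟩}ᶜ
  have hQS : Q ∈ S := by simp [S, Q, Ne.symm hxq, Ne.symm hyq]
  obtain ⟨hz1, hz2, hz3⟩ := hm Q hQS
  set Z := m Q
  have h3 : Matchable (contract F a p q) (S \ {Q, Z}) := by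
    refine ⟨m, fun w hw ↦ ?_⟩
    have h4 := hm w hw.1
    refine ⟨⟨h4.1, ?_⟩, h4.2⟩
    have h5 := hw.2
    simp only [Set.mem_insert_iff, Set.mem_singleton_iff, not_or] at h5 ⊢
    exact ⟨fun h ↦ h5.2 (by rw [← h4.2.1, h]), fun h ↦ h5.1 (by rw [← h4.2.1, h, hz2])⟩
  have h4 := h3.of_contract (fun w hw hwq ↦ hw.2 (Or.inl (Subtype.ext hwq)))
  have hZ := Z.2
  have hZq : Z.1 ≠ q := fun h ↦ hz3.1 (Subtype.ext h.symm)
  have hZ' : Z.1 ≠ x ∧ Z.1 ≠ y := by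
    simp only [S, Set.mem_compl_iff, Set.mem_insert_iff, Set.mem_singleton_iff, not_or,
      Subtype.ext_iff] at hz1
    exact hz1
  have hset : (Subtype.val '' (S \ {Q, Z}) : Set V) = {a, p, q, Z.1, x, y}ᶜ := by
    ext w
    simp only [Set.mem_compl_iff, Set.mem_insert_iff, Set.mem_singleton_iff, Set.mem_image,
      Set.mem_sdiff, S, Subtype.ext_iff, Q]
    constructor
    · rintro ⟨v, hv, rfl⟩
      have := v.2
      tauto
    · exact fun hw ↦ ⟨⟨w, by tauto, by tauto⟩, by dsimp only; tauto, rfl⟩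
  rw [hset] at h4
  -- The edge from the merged vertex to its mate lifts to `q` or `p`; this decides which of the two
  -- is left for `a`.
  have h5 : F.Adj q Z.1 ∨ F.Adj p Z.1 := by
    rcases hz3.2 with h | h | h
    · exact Or.inl h
    · exact Or.inr h.2
    · exact absurd h.1 hZq
  rcases h5 with h5 | h5
  · refine (h4.add_edge h5 (by simp) (by simp) rfl).add_edge hap ?_ ?_ ?_
    · simp [hqa, hZ.1.symm]
    · simp [hpq, hZ.2.symm]
    · ext w; simp only [Set.mem_compl_iff, Set.mem_insert_iff, Set.mem_singleton_iff,
        Set.mem_union]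
      grind
  · refine (h4.add_edge h5 (by simp) (by simp) rfl).add_edge haq ?_ ?_ ?_
    · simp [hpa, hZ.1.symm]
    · simp [hpq.symm, Ne.symm hZq]
    · ext w; simp only [Set.mem_compl_iff, Set.mem_insert_iff, Set.mem_singleton_iff,
        Set.mem_union]
      grind

end contract

/-! ### The retract in terms of the contraction -/

section retract

variable {F : SimpleGraph V}

lemma retract_isLink {f : Sym2 V}
    {C D : (SimpleGraph.fromEdgeSet (edgesAtDegreeTwo F)).ConnectedComponent} :
    (retract F).IsLink f C D ↔ ∃ u v, f = s(u, v) ∧ F.Adj u v ∧ s(u, v) ∉ edgesAtDegreeTwo F ∧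
      (SimpleGraph.fromEdgeSet (edgesAtDegreeTwo F)).connectedComponentMk u = C ∧
      (SimpleGraph.fromEdgeSet (edgesAtDegreeTwo F)).connectedComponentMk v = D := by
  simp only [retract, Graph.map_isLink, Relation.Map, Graph.deleteEdges_isLink,
    Graph.ofSimpleGraph_isLink]
  constructor
  · rintro ⟨u, v, ⟨⟨rfl, h1⟩, h2⟩, h3, h4⟩; exact ⟨u, v, rfl, h1, h2, h3, h4⟩
  · rintro ⟨u, v, rfl, h1, h2, h3, h4⟩; exact ⟨u, v, ⟨⟨rfl, h1⟩, h2⟩, h3, h4⟩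

lemma mem_vertexSet_retract
    (C : (SimpleGraph.fromEdgeSet (edgesAtDegreeTwo F)).ConnectedComponent) :
    C ∈ (retract F).vertexSet := by
  induction C using SimpleGraph.ConnectedComponent.ind with | h v => exact ⟨v, trivial, rfl⟩

/-- The vertices of the retract correspond to the vertices of a transversal of the contracted
components. -/
noncomputable def retractEquiv {S : Type*} (ι : S → V) (r : V → S)
    (h : ∀ x y, (SimpleGraph.fromEdgeSet (edgesAtDegreeTwo F)).connectedComponentMk x =
      (SimpleGraph.fromEdgeSet (edgesAtDegreeTwo F)).connectedComponentMk y ↔ r x = r y)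
    (hr : ∀ s, r (ι s) = s) : S ≃ (retract F).vertexSet :=
  Equiv.ofBijective (fun s ↦ ⟨_, mem_vertexSet_retract
      ((SimpleGraph.fromEdgeSet (edgesAtDegreeTwo F)).connectedComponentMk (ι s))⟩) <| by
    constructor
    · intro s t hst
      have := (h _ _).1 (congrArg Subtype.val hst)
      rwa [hr, hr] at this
    · rintro ⟨C, hC⟩
      induction C using SimpleGraph.ConnectedComponent.ind with | h v => ?_
      exact ⟨r v, Subtype.ext ((h _ _).2 (hr _))⟩

lemma retractEquiv_adj {S : Type*} (ι : S → V) (r : V → S)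
    (h : ∀ x y, (SimpleGraph.fromEdgeSet (edgesAtDegreeTwo F)).connectedComponentMk x =
      (SimpleGraph.fromEdgeSet (edgesAtDegreeTwo F)).connectedComponentMk y ↔ r x = r y)
    (hr : ∀ s, r (ι s) = s) (s t : S) :
    (retract F).toSimpleGraph.Adj (retractEquiv ι r h hr s) (retractEquiv ι r h hr t) ↔
      s ≠ t ∧ ∃ u v, F.Adj u v ∧ s(u, v) ∉ edgesAtDegreeTwo F ∧ r u = s ∧ r v = t := by
  rw [Graph.toSimpleGraph_adj, (retractEquiv ι r h hr).injective.ne_iff]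
  refine and_congr_right fun _ ↦ ?_
  simp only [Graph.Adj, retract_isLink]
  have h' : ∀ u s, (SimpleGraph.fromEdgeSet (edgesAtDegreeTwo F)).connectedComponentMk u =
      (retractEquiv ι r h hr s).1 ↔ r u = s := by
    intro u s
    change _ = (SimpleGraph.fromEdgeSet (edgesAtDegreeTwo F)).connectedComponentMk (ι s) ↔ _
    rw [h, hr]
  simp only [h']
  constructor
  · rintro ⟨f, u, v, -, h⟩; exact ⟨u, v, h⟩
  · rintro ⟨u, v, h⟩; exact ⟨_, u, v, rfl, h⟩

lemma retract_loopless_iff {S : Type*} (r : V → S)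
    (h : ∀ x y, (SimpleGraph.fromEdgeSet (edgesAtDegreeTwo F)).connectedComponentMk x =
      (SimpleGraph.fromEdgeSet (edgesAtDegreeTwo F)).connectedComponentMk y ↔ r x = r y) :
    (retract F).Loopless ↔ ∀ u v, F.Adj u v → s(u, v) ∉ edgesAtDegreeTwo F → r u ≠ r v := by
  rw [Graph.loopless_iff]
  simp only [Graph.IsLoopAt, retract_isLink]
  constructor
  · exact fun hl u v huv hD hr ↦ hl s(u, v) _ ⟨u, v, rfl, huv, hD, rfl, ((h _ _).2 hr).symm⟩
  · rintro hl f C ⟨u, v, -, huv, hD, h1, h2⟩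
    exact hl u v huv hD ((h _ _).1 (h1.trans h2.symm))

lemma edgesAtDegreeTwo_eq_empty (hF : ∀ v, deg F v ≠ 2) : edgesAtDegreeTwo F = ∅ := by
  ext f
  simp only [edgesAtDegreeTwo, Set.mem_ofPred_eq, Set.mem_empty_iff_false, iff_false]
  rintro ⟨-, v, -, hv⟩
  exact hF v hv

lemma connectedComponentMk_eq_iff_of_forall_deg (hF : ∀ v, deg F v ≠ 2) (x y : V) :
    (SimpleGraph.fromEdgeSet (edgesAtDegreeTwo F)).connectedComponentMk x =
      (SimpleGraph.fromEdgeSet (edgesAtDegreeTwo F)).connectedComponentMk y ↔ id x = id y := by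
  rw [SimpleGraph.ConnectedComponent.eq, edgesAtDegreeTwo_eq_empty hF]
  simp

lemma isMultiBrick_retract_iff_of_forall_deg (hF : ∀ v, deg F v ≠ 2) :
    IsMultiBrick (retract F) ↔ IsBrick F := by
  have hκ := connectedComponentMk_eq_iff_of_forall_deg hF
  have hE := edgesAtDegreeTwo_eq_empty hF
  have hadj := retractEquiv_adj (F := F) id id hκ (fun _ ↦ rfl)
  set φ := retractEquiv (F := F) id id hκ (fun _ ↦ rfl)
  have hadj' : ∀ s t, (retract F).toSimpleGraph.Adj (φ s) (φ t) ↔ F.Adj s t := by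
    intro s t
    rw [hadj, hE]
    constructor
    · rintro ⟨-, u, v, h, -, rfl, rfl⟩; exact h
    · exact fun h ↦ ⟨h.ne, s, t, h, by simp, rfl, rfl⟩
  have hl : (retract F).Loopless := by
    rw [retract_loopless_iff id hκ]
    exact fun u v h _ ↦ h.ne
  refine ⟨fun h ↦ h.2.of_equiv φ.symm fun x y hxy ↦ ?_, fun h ↦ ⟨hl, h.of_equiv φ fun x y hxy ↦ ?_⟩⟩
  · rw [← hadj']; simpa using hxy
  · exact (hadj' _ _).2 hxy

lemma simple_retract_of_forall_deg (hF : ∀ v, deg F v ≠ 2) : (retract F).Simple := by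
  have hκ := connectedComponentMk_eq_iff_of_forall_deg hF
  have hl : (retract F).Loopless := by
    rw [retract_loopless_iff id hκ]
    exact fun u v h _ ↦ h.ne
  refine { toLoopless := hl, eq_of_isLink := fun f g C D hf hg ↦ ?_ }
  rw [retract_isLink] at hf hg
  obtain ⟨u, v, rfl, -, -, h1, h2⟩ := hf
  obtain ⟨u', v', rfl, -, -, h3, h4⟩ := hg
  have e1 := (hκ _ _).1 (h1.trans h3.symm)
  have e2 := (hκ _ _).1 (h2.trans h4.symm)
  simp only [id] at e1 e2
  rw [e1, e2]

variable {a p q : V}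

lemma edgesAtDegreeTwo_eq_pair (hN : ∀ z, F.Adj a z ↔ z = p ∨ z = q) (hpq : p ≠ q)
    (hF : ∀ v, deg F v = 2 → v = a) : edgesAtDegreeTwo F = {s(a, p), s(a, q)} := by
  have ha : deg F a = 2 := deg_eq_two_iff.2 ⟨p, q, hpq, hN⟩
  ext f
  simp only [edgesAtDegreeTwo, Set.mem_ofPred_eq, Set.mem_insert_iff, Set.mem_singleton_iff]
  constructor
  · rintro ⟨h1, v, hv, h2⟩
    obtain rfl := hF v h2
    obtain ⟨w, rfl⟩ := hv
    rcases (hN w).1 h1 with rfl | rfl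
    · exact Or.inl rfl
    · exact Or.inr rfl
  · rintro (rfl | rfl)
    · exact ⟨(hN p).2 (Or.inl rfl), a, by simp, ha⟩
    · exact ⟨(hN q).2 (Or.inr rfl), a, by simp, ha⟩

open Classical in
/-- The representative of a vertex in the contraction of `a`, `p` and `q`. -/
noncomputable def contractRep (hqa : q ≠ a) (hqp : q ≠ p) (x : V) : {x : V // x ≠ a ∧ x ≠ p} :=
  if h : x ≠ a ∧ x ≠ p then ⟨x, h⟩ else ⟨q, hqa, hqp⟩

lemma contractRep_coe (hqa : q ≠ a) (hqp : q ≠ p) (x : {x : V // x ≠ a ∧ x ≠ p}) :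
    contractRep hqa hqp x.1 = x := by simp [contractRep, x.2]

lemma contractRep_val (hqa : q ≠ a) (hqp : q ≠ p) (x : V) :
    ((contractRep hqa hqp x).1 = x ∧ x ≠ a ∧ x ≠ p) ∨
      ((contractRep hqa hqp x).1 = q ∧ (x = a ∨ x = p)) := by
  unfold contractRep
  split_ifs with h
  · exact Or.inl ⟨rfl, h⟩
  · exact Or.inr ⟨rfl, by tauto⟩

lemma connectedComponentMk_eq_iff_contractRep (hN : ∀ z, F.Adj a z ↔ z = p ∨ z = q)
    (hpq : p ≠ q) (hqa : q ≠ a) (hF : ∀ v, deg F v = 2 → v = a) (x y : V) :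
    (SimpleGraph.fromEdgeSet (edgesAtDegreeTwo F)).connectedComponentMk x =
      (SimpleGraph.fromEdgeSet (edgesAtDegreeTwo F)).connectedComponentMk y ↔
    contractRep hqa hpq.symm x = contractRep hqa hpq.symm y := by
  have hE := edgesAtDegreeTwo_eq_pair hN hpq hF
  have hap := ((hN p).2 (Or.inl rfl)).ne
  rw [SimpleGraph.ConnectedComponent.eq]
  have hra : (contractRep hqa hpq.symm a).1 = q := by grind [contractRep_val hqa hpq.symm a]
  have hrp : (contractRep hqa hpq.symm p).1 = q := by grind [contractRep_val hqa hpq.symm p]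
  have hrq : (contractRep hqa hpq.symm q).1 = q := by grind [contractRep_val hqa hpq.symm q]
  constructor
  · rintro ⟨w⟩
    induction w with
    | nil => rfl
    | cons h _ ih =>
      refine Eq.trans ?_ ih
      rw [SimpleGraph.fromEdgeSet_adj, hE] at h
      apply Subtype.ext
      simp only [Set.mem_insert_iff, Set.mem_singleton_iff, Sym2.eq_iff] at h
      grind
  · have e1 : (SimpleGraph.fromEdgeSet (edgesAtDegreeTwo F)).Reachable a q := by
      refine SimpleGraph.Adj.reachable ?_
      rw [SimpleGraph.fromEdgeSet_adj, hE]; exact ⟨by simp, hqa.symm⟩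
    have e2 : (SimpleGraph.fromEdgeSet (edgesAtDegreeTwo F)).Reachable a p := by
      refine SimpleGraph.Adj.reachable ?_
      rw [SimpleGraph.fromEdgeSet_adj, hE]; exact ⟨by simp, hap⟩
    have e3 : ∀ x, (SimpleGraph.fromEdgeSet (edgesAtDegreeTwo F)).Reachable x
        (contractRep hqa hpq.symm x).1 := by
      intro x
      rcases contractRep_val hqa hpq.symm x with ⟨h, -⟩ | ⟨h, rfl | rfl⟩
      · rw [h]
      · rw [h]; exact e1
      · rw [h]; exact e2.symm.trans e1
    intro h
    exact (e3 x).trans (h ▸ (e3 y).symm)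

/-- The retract may have multiple edges but `contract` records only adjacency. A loop can arise only
from an edge `pq`, which is why looplessness appears as a separate condition. -/
lemma isMultiBrick_retract_iff (hN : ∀ z, F.Adj a z ↔ z = p ∨ z = q) (hpq : p ≠ q)
    (hF : ∀ v, deg F v = 2 → v = a) :
    IsMultiBrick (retract F) ↔ ¬ F.Adj p q ∧ IsBrick (contract F a p q) := by
  have hap := ((hN p).2 (Or.inl rfl)).ne
  have hqa := ((hN q).2 (Or.inr rfl)).ne.symm
  have hκ := connectedComponentMk_eq_iff_contractRep hN hpq hqa hF
  have hE := edgesAtDegreeTwo_eq_pair hN hpq hF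
  have hE' : ∀ u v, F.Adj u v → (s(u, v) ∉ edgesAtDegreeTwo F ↔ u ≠ a ∧ v ≠ a) := by
    intro u v huv
    rw [hE]
    simp only [Set.mem_insert_iff, Set.mem_singleton_iff, Sym2.eq_iff]
    have h1 := huv.symm
    grind
  have hadj := retractEquiv_adj (F := F) Subtype.val _ hκ (contractRep_coe hqa hpq.symm)
  set φ := retractEquiv (F := F) Subtype.val _ hκ (contractRep_coe hqa hpq.symm)
  have hadj' : ∀ s t, (retract F).toSimpleGraph.Adj (φ s) (φ t) ↔
      (contract F a p q).Adj s t := by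
    intro s t
    rw [hadj, contract_adj]
    refine and_congr_right fun hst ↦ ?_
    constructor
    · rintro ⟨u, v, huv, hD, rfl, rfl⟩
      have h1 := (hE' u v huv).1 hD
      rw [ne_eq, Subtype.ext_iff] at hst
      have h2 := huv.symm
      have h3 := contractRep_val hqa hpq.symm u
      have h4 := contractRep_val hqa hpq.symm v
      rcases h3 with ⟨h3, h5⟩ | ⟨h3, rfl | rfl⟩ <;> rcases h4 with ⟨h4, h6⟩ | ⟨h4, rfl | rfl⟩ <;>
        simp_all
    · have hs := s.2
      have ht := t.2
      have hrs := contractRep_coe hqa hpq.symm s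
      have hrt := contractRep_coe hqa hpq.symm t
      have hrp : contractRep hqa hpq.symm p = ⟨q, hqa, hpq.symm⟩ := by simp [contractRep]
      rintro (h | ⟨h1, h⟩ | ⟨h1, h⟩)
      · exact ⟨_, _, h, (hE' _ _ h).2 ⟨hs.1, ht.1⟩, hrs, hrt⟩
      · exact ⟨_, _, h, (hE' _ _ h).2 ⟨hap.symm, ht.1⟩, hrp.trans (Subtype.ext h1.symm), hrt⟩
      · exact ⟨_, _, h, (hE' _ _ h).2 ⟨hs.1, hap.symm⟩, hrs, hrp.trans (Subtype.ext h1.symm)⟩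
  have hl : (retract F).Loopless ↔ ¬ F.Adj p q := by
    rw [retract_loopless_iff _ hκ]
    constructor
    · intro h hpq'
      refine h p q hpq' ((hE' _ _ hpq').2 ⟨hap.symm, hqa⟩) (Subtype.ext ?_)
      grind [contractRep_val hqa hpq.symm p, contractRep_val hqa hpq.symm q]
    · intro h u v huv hD huv'
      have h1 := (hE' _ _ huv).1 hD
      have h2 := congrArg Subtype.val huv'
      have h3 := huv.symm
      have h4 := huv.ne
      grind [contractRep_val hqa hpq.symm u, contractRep_val hqa hpq.symm v]
  refine and_congr hl
    ⟨fun h ↦ h.of_equiv φ.symm fun x y hxy ↦ ?_, fun h ↦ h.of_equiv φ fun x y hxy ↦ ?_⟩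
  · rw [← hadj']; simpa using hxy
  · exact (hadj' _ _).2 hxy

/-- Multiple edges of the retract come from a 4-cycle through the vertex of degree two. -/
lemma exists_common_neighbor_of_not_simple (hN : ∀ z, F.Adj a z ↔ z = p ∨ z = q) (hpq : p ≠ q)
    (hF : ∀ v, deg F v = 2 → v = a) (hl : (retract F).Loopless) (hs : ¬ (retract F).Simple) :
    ∃ c, c ≠ a ∧ F.Adj p c ∧ F.Adj q c := by
  by_contra! hcon
  refine hs { toLoopless := hl, eq_of_isLink := fun f g C D hf hg ↦ ?_ }
  have hap := ((hN p).2 (Or.inl rfl)).ne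
  have hqa := ((hN q).2 (Or.inr rfl)).ne.symm
  have hκ := connectedComponentMk_eq_iff_contractRep hN hpq hqa hF
  have hE := edgesAtDegreeTwo_eq_pair hN hpq hF
  have hE' : ∀ u v, F.Adj u v → s(u, v) ∉ edgesAtDegreeTwo F → u ≠ a ∧ v ≠ a := by
    intro u v huv
    rw [hE]
    simp only [Set.mem_insert_iff, Set.mem_singleton_iff, Sym2.eq_iff]
    have h1 := huv.symm
    grind
  have hl' := (retract_loopless_iff _ hκ).1 hl
  rw [retract_isLink] at hf hg
  obtain ⟨u, v, rfl, huv, hD, h1, h2⟩ := hf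
  obtain ⟨u', v', rfl, huv', hD', h3, h4⟩ := hg
  have e1 := congrArg Subtype.val ((hκ _ _).1 (h1.trans h3.symm))
  have e2 := congrArg Subtype.val ((hκ _ _).1 (h2.trans h4.symm))
  have e4 := hE' _ _ huv hD
  have e5 := hE' _ _ huv' hD'
  have key : ∀ w w', w ≠ a → w' ≠ a →
      (contractRep hqa hpq.symm w).1 = (contractRep hqa hpq.symm w').1 →
      w = w' ∨ (w = p ∧ w' = q) ∨ (w = q ∧ w' = p) := by
    intro w w' hw hw' h
    rcases contractRep_val hqa hpq.symm w with ⟨h5, h6⟩ | ⟨h5, h6⟩ <;>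
    rcases contractRep_val hqa hpq.symm w' with ⟨h7, h8⟩ | ⟨h7, h8⟩ <;> grind
  -- Parallel edges have ends that agree up to exchanging `p` and `q`. A proper exchange at one end
  -- gives a common neighbour; at both ends it would give either the same edge reversed or a loop.
  rcases key _ _ e4.1 e5.1 e1 with rfl | ⟨rfl, rfl⟩ | ⟨rfl, rfl⟩ <;>
  rcases key _ _ e4.2 e5.2 e2 with rfl | ⟨rfl, rfl⟩ | ⟨rfl, rfl⟩
  · rfl
  · exact absurd huv'.symm (hcon _ e4.1 huv.symm)
  · exact absurd huv.symm (hcon _ e4.1 huv'.symm)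
  · exact absurd huv' (hcon _ e4.2 huv)
  · exact absurd huv (F.loopless.irrefl _)
  · exact Sym2.eq_swap
  · exact absurd huv (hcon _ e4.2 huv')
  · exact Sym2.eq_swap
  · exact absurd huv (F.loopless.irrefl _)

end retract

/-! ### Degrees after deleting an edge -/

section degree

variable {F : SimpleGraph V} {a b v : V}

lemma deg_deleteEdges_of_ne (ha : v ≠ a) (hb : v ≠ b) : deg (F.deleteEdges {s(a, b)}) v = deg F v := by
  unfold deg
  congr 1
  ext z
  simp only [SimpleGraph.mem_neighborSet, deleteEdges_singleton_adj]
  tauto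

lemma deg_deleteEdges_left [Finite V] (hab : F.Adj a b) :
    deg (F.deleteEdges {s(a, b)}) a + 1 = deg F a := by
  unfold deg
  rw [← Set.ncard_sdiff_singleton_add_one (show b ∈ F.neighborSet a from hab) (Set.toFinite _)]
  congr 2
  ext z
  simp only [SimpleGraph.mem_neighborSet, deleteEdges_singleton_adj, Set.mem_sdiff,
    Set.mem_singleton_iff]
  have := hab.ne
  tauto

lemma deg_deleteEdges_right [Finite V] (hab : F.Adj a b) :
    deg (F.deleteEdges {s(a, b)}) b + 1 = deg F b := by
  rw [Sym2.eq_swap]; exact deg_deleteEdges_left hab.symm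

lemma IsBrick.eq_of_deg_deleteEdges_eq_two [Finite V] (hF : IsBrick F) (hab : F.Adj a b)
    (hb : deg F b ≠ 3) (h : deg (F.deleteEdges {s(a, b)}) v = 2) : v = a := by
  by_contra hva
  by_cases hvb : v = b
  · subst hvb
    have := deg_deleteEdges_right hab
    omega
  · rw [deg_deleteEdges_of_ne hva hvb] at h
    have := hF.three_le_deg v
    omega

lemma IsBrick.deg_deleteEdges_ne_two [Finite V] (hF : IsBrick F) (hab : F.Adj a b)
    (ha : deg F a ≠ 3) (hb : deg F b ≠ 3) : deg (F.deleteEdges {s(a, b)}) v ≠ 2 := by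
  intro h
  obtain rfl := hF.eq_of_deg_deleteEdges_eq_two hab hb h
  have := deg_deleteEdges_left hab
  omega

lemma exists_neighbors_of_deg_eq_three (ha : deg F a = 3) (hab : F.Adj a b) :
    ∃ p q, b ≠ p ∧ b ≠ q ∧ p ≠ q ∧ ∀ z, F.Adj a z ↔ z = b ∨ z = p ∨ z = q := by
  obtain ⟨x, y, z, hxy, hxz, hyz, h⟩ := deg_eq_three_iff.1 ha
  rcases (h b).1 hab with rfl | rfl | rfl
  · exact ⟨y, z, hxy, hxz, hyz, h⟩
  · exact ⟨x, z, hxy.symm, hyz, hxz, fun w ↦ by rw [h]; tauto⟩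
  · exact ⟨x, y, hxz.symm, hyz.symm, hxy, fun w ↦ by rw [h]; tauto⟩

end degree

/-- If `z` were the only neighbour of `a`, every perfect matching would contain `az`, so `z` would
have no other edge and `{a, z}` would be a component. -/
lemma IsMatchingCovered.exists_adj_ne [Finite V] {F : SimpleGraph V} (h : IsMatchingCovered F)
    (hV : 3 ≤ Nat.card V) (a z : V) : ∃ w, w ≠ z ∧ F.Adj a w := by
  by_contra! hcon
  have hz : ∀ w, F.Adj a w → w = z := fun w hw ↦ by
    by_contra hne
    exact hcon w hne hw
  have h1 : ∀ y, y ∈ ({a, z} : Set V) := by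
    refine mem_of_connected_univ h.connected (x := a) (by simp) ?_
    rintro u (rfl | rfl) v huv
    · exact Or.inr (hz v huv)
    · obtain ⟨m, hm, hmu⟩ := h.exists_isMating huv
      have h2 : m a = u := hz _ (hm a).2
      left
      rw [← hmu, ← h2, (hm a).1]
  have h2 := Set.ncard_le_ncard (s := Set.univ) (t := {a, z}) (fun y _ ↦ h1 y) (Set.toFinite _)
  have h3 := Set.ncard_insert_le a {z}
  rw [Set.ncard_univ] at h2
  rw [Set.ncard_singleton] at h3
  omega

/-! ### The position of the edges of `R` -/

section RBrick

variable {G : SimpleGraph V} {R : Set (Sym2 V)}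

/-- The colour classes have equal size. If `A` were independent in `G`, deleting two vertices of the
other class would leave too few mates for `A`. -/
lemma IsRBrick.exists_adj_side [Finite V] (hG : IsRBrick G R) {A : Set V}
    (hA : IsSide (G.deleteEdges R) A) : ∃ x ∈ A, ∃ y ∈ A, G.Adj x y := by
  obtain ⟨m₀, hm₀⟩ := hG.isRemovableDoubleton.isMatchingCovered.exists_mating
  have hcard := hm₀.ncard_eq hA
  have h1 := Set.ncard_add_ncard_compl A
  have h2 := hG.isBrick.threeConnected.four_le_card
  obtain ⟨u, hu, v, hv, huv⟩ := (Set.one_lt_ncard_iff (Set.toFinite Aᶜ)).1 (by omega) |>.imp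
    fun u h ↦ (show u ∈ Aᶜ ∧ ∃ v ∈ Aᶜ, u ≠ v by obtain ⟨v, h1, h2, h3⟩ := h; exact ⟨h1, v, h2, h3⟩)
  by_contra! hcon
  obtain ⟨m, hm⟩ := hG.isBrick.matchable huv
  have hsub : A ⊆ {u, v}ᶜ := by
    rintro z hz (rfl | rfl)
    · exact hu hz
    · exact hv hz
  have h3 : A.ncard ≤ (Aᶜ \ {u, v}).ncard := by
    refine Matchable.ncard_le (fun x hx ↦ (hm x hx).2.1) hsub fun x hx ↦ ?_
    have h4 := hm x (hsub hx)
    exact ⟨fun h ↦ hcon x hx _ h h4.2.2, h4.1⟩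
  have h5 : ({u, v} : Set V) ⊆ Aᶜ := by rintro z (rfl | rfl) <;> assumption
  rw [Set.ncard_sdiff h5, Set.ncard_pair huv] at h3
  omega

/-- One edge of the removable doubleton lies in each colour class. -/
lemma IsRBrick.exists_eq_pair [Finite V] (hG : IsRBrick G R) {A : Set V}
    (hA : IsSide (G.deleteEdges R) A) : ∃ a₁ ∈ A, ∃ a₂ ∈ A, ∃ b₁ ∉ A, ∃ b₂ ∉ A,
      R = {s(a₁, a₂), s(b₁, b₂)} := by
  obtain ⟨a₁, h1, a₂, h2, h12⟩ := hG.exists_adj_side hA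
  obtain ⟨b₁, h3, b₂, h4, h34⟩ := hG.exists_adj_side hA.compl
  refine ⟨a₁, h1, a₂, h2, b₁, h3, b₂, h4, ?_⟩
  have h5 : s(a₁, a₂) ∈ R := by
    by_contra h
    exact hA.notMem h1 (SimpleGraph.deleteEdges_adj.2 ⟨h12, h⟩) h2
  have h6 : s(b₁, b₂) ∈ R := by
    by_contra h
    exact h4 (hA.mem h3 (SimpleGraph.deleteEdges_adj.2 ⟨h34, h⟩))
  have h7 : s(a₁, a₂) ≠ s(b₁, b₂) := by
    intro h
    rcases Sym2.eq_iff.1 h with ⟨rfl, -⟩ | ⟨rfl, -⟩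
    · exact h3 h1
    · exact h4 h1
  symm
  refine Set.eq_of_subset_of_ncard_le ?_ ?_ (Set.toFinite _)
  · rintro f (rfl | rfl) <;> assumption
  · rw [Set.ncard_pair h7, hG.isRemovableDoubleton.ncard_eq]

lemma adj_deleteEdges_of_notMem_ends {x y : V} (hx : x ∉ ends R) (h : G.Adj x y) :
    (G.deleteEdges R).Adj x y :=
  SimpleGraph.deleteEdges_adj.2 ⟨h, fun h' ↦ hx ⟨_, h', by simp⟩⟩

lemma IsRBrick.even_card [Finite V] (hG : IsRBrick G R) : Even (Nat.card V) := by
  obtain ⟨m, hm⟩ := hG.isRemovableDoubleton.isMatchingCovered.exists_mating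
  rw [← Set.ncard_univ]
  exact even_ncard_of_involution (Set.toFinite _)
    fun x _ ↦ ⟨trivial, (hm x).1, (hm x).2.ne.symm⟩

lemma IsRCompatible.adj {a b : V} (h : IsRCompatible G R s(a, b)) :
    (G.deleteEdges R).Adj a b := h.2.1

/-- In `H - ab` the vertex `a` keeps two neighbours; with `b` and an `R`-mate it would have degree
at least four. -/
lemma IsRCompatible.notMem_ends [Finite V] (hG : IsRBrick G R) {a b : V}
    (h : IsRCompatible G R s(a, b)) (ha : deg G a = 3) : a ∉ ends R := by
  rintro ⟨f, hf, haf⟩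
  obtain ⟨r, rfl⟩ := haf
  have hV := hG.isBrick.threeConnected.four_le_card
  obtain ⟨x, -, hx⟩ := h.2.2.exists_adj_ne (by omega) a a
  obtain ⟨y, hyx, hy⟩ := h.2.2.exists_adj_ne (by omega) a x
  rw [deleteEdges_singleton_adj, SimpleGraph.deleteEdges_adj] at hx hy
  have hr : G.Adj a r := hG.isRemovableDoubleton.subset_edgeSet hf
  have hb := SimpleGraph.deleteEdges_adj.1 h.adj
  obtain ⟨p, q, h1, h2, h3, hN⟩ := exists_neighbors_of_deg_eq_three ha hb.1
  have e1 := (hN r).1 hr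
  have e2 := (hN x).1 hx.1.1
  have e3 := (hN y).1 hy.1.1
  have e4 : r ≠ b := by rintro rfl; exact hb.2 hf
  have e5 : r ≠ x := by rintro rfl; exact hx.1.2 hf
  have e6 : r ≠ y := by rintro rfl; exact hy.1.2 hf
  grind

lemma isRCompatible_swap {a b : V} : IsRCompatible G R s(a, b) ↔ IsRCompatible G R s(b, a) := by
  rw [Sym2.eq_swap]

lemma adj_deleteEdges_iff {F : SimpleGraph V} {a b p q : V}
    (hN : ∀ z, F.Adj a z ↔ z = b ∨ z = p ∨ z = q) (hbp : b ≠ p) (hbq : b ≠ q) (z : V) :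
    (F.deleteEdges {s(a, b)}).Adj a z ↔ z = p ∨ z = q := by
  have := ((hN b).2 (Or.inl rfl)).ne
  rw [deleteEdges_singleton_adj, hN]
  grind

end RBrick

/-! ### Barriers created by a vertex of degree two -/

section barrier

variable {F : SimpleGraph V}

/-- Deleting `p` and `q` isolates `a`, so there is an odd component. There are at most two by the
perfect matching, and evenly many by parity. -/
lemma isBarrier_neighbors [Finite V] {a p q : V} (hN : ∀ z, F.Adj a z ↔ z = p ∨ z = q)
    (hpq : p ≠ q) (hM : Matchable F Set.univ) (hV : Even (Nat.card V)) : IsBarrier F {p, q} := by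
  have hap := ((hN p).2 (Or.inl rfl)).ne
  have haq := ((hN q).2 (Or.inr rfl)).ne
  refine ⟨⟨p, by simp⟩, ?_⟩
  have ha : a ∈ ({p, q} : Set V)ᶜ := by simp [hap, haq]
  have h1 := ncard_oddComponents_induce_le (F := F) (S := {p, q}) (T := ∅) (by simp)
    (by rwa [Set.compl_empty])
  rw [Set.sdiff_empty, Set.ncard_pair hpq] at h1
  rw [Set.ncard_pair hpq]
  have h2 : 0 < (F.induce ({p, q} : Set V)ᶜ).oddComponents.ncard := by
    rw [Set.ncard_pos]
    refine ⟨(F.induce ({p, q} : Set V)ᶜ).connectedComponentMk ⟨a, ha⟩, ?_⟩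
    have h3 : ((F.induce ({p, q} : Set V)ᶜ).connectedComponentMk ⟨a, ha⟩).supp = {⟨a, ha⟩} := by
      ext w
      rw [SimpleGraph.ConnectedComponent.mem_supp_iff, SimpleGraph.ConnectedComponent.eq,
        Set.mem_singleton_iff]
      refine ⟨fun h ↦ ?_, by rintro rfl; rfl⟩
      obtain ⟨P⟩ := h.symm
      cases P with
      | nil => rfl
      | @cons _ v _ h _ =>
        have hv := v.2
        simp only [Set.mem_compl_iff, Set.mem_insert_iff, Set.mem_singleton_iff] at hv
        exact absurd ((hN _).1 h) hv
    change Odd _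
    rw [h3, Set.ncard_singleton]
    exact odd_one
  have h3 : ¬ Odd (F.induce ({p, q} : Set V)ᶜ).oddComponents.ncard := by
    rw [SimpleGraph.odd_ncard_oddComponents]
    change ¬ Odd (({p, q} : Set V)ᶜ).ncard
    have h4 := Set.ncard_add_ncard_compl ({p, q} : Set V)
    rw [Set.ncard_pair hpq] at h4
    grind
  grind

lemma connected_induce_of_subset {S S' : Set V} (h : (F.induce S').Connected) (hsub : S' ⊆ S)
    (hadj : ∀ x ∈ S, x ∉ S' → ∃ z ∈ S', F.Adj x z) : (F.induce S).Connected := by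
  obtain ⟨c, hc⟩ := h.nonempty
  refine connected_induce_of_root (hsub hc) fun T hcT hcl y hy ↦ ?_
  have h1 := mem_of_connected h hc hcT fun u hu huT v hv huv ↦ hcl u (hsub hu) huT v (hsub hv) huv
  by_cases hyS : y ∈ S'
  · exact h1 hyS
  · obtain ⟨z, hz, hyz⟩ := hadj y hy hyS
    exact hcl z (hsub hz) (h1 hz) y hy hyz.symm

lemma connected_induce_of_adj {F' : SimpleGraph V} {S : Set V} (h : (F.induce S).Connected)
    (hadj : ∀ u ∈ S, ∀ v ∈ S, F.Adj u v → F'.Adj u v) : (F'.induce S).Connected :=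
  h.mono fun u v huv ↦ hadj u u.2 v v.2 huv

lemma exists_ne_of_one_lt_ncard [Finite V] {S : Set V} (h : 1 < S.ncard) (x : V) :
    ∃ y ∈ S, y ≠ x := by
  by_contra! hcon
  have := Set.ncard_le_ncard (s := S) (t := {x}) hcon (Set.toFinite _)
  rw [Set.ncard_singleton] at this
  omega

/-- The only nontrivial barrier of a matching covered graph with one vertex of degree two whose
retract is a brick. -/
lemma IsBarrier.eq_pair [Finite V] {a p q : V} (hF : IsMatchingCovered F)
    (hN : ∀ z, F.Adj a z ↔ z = p ∨ z = q) (hpq : p ≠ q) (hpq' : ¬ F.Adj p q)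
    (hK : IsBrick (contract F a p q)) (hp : 3 ≤ deg F p) (hq : 3 ≤ deg F q) {S : Set V}
    (hS : IsBarrier F S) (hS1 : 1 < S.ncard) : S = {p, q} := by
  have hap := (hN p).2 (Or.inl rfl)
  have haq := (hN q).2 (Or.inr rfl)
  have hpair : ∀ x ∈ S, ∀ y ∈ S, x ≠ y → x ≠ a → y ≠ a → (x = p ∧ y = q) ∨ (x = q ∧ y = p) := by
    intro x hx y hy hxy hxa hya
    by_contra! hcon
    exact hS.not_matchable hx hy hxy
      (hK.matchable_of_contract hap haq hpq hxa hya hxy (by tauto) (by tauto))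
  -- A nontrivial barrier containing `a` would be some `{a, y}` with `y` different from `p` and `q`.
  -- Its complement is connected, because `p` and `q` retain neighbours in the connected remainder,
  -- so it has only one component.
  have haS : a ∉ S := by
    intro ha
    obtain ⟨y, hy, hya⟩ := exists_ne_of_one_lt_ncard hS1 a
    have hadj : ∀ z, F.Adj a z → z ∉ S := fun z hz hzS ↦
      hS.not_matchable ha hzS hz.ne ((isAdmissible_iff_matchable hz).1 (hF.admissible _ hz))
    have hpS := hadj p hap
    have hqS := hadj q haq
    have hSe : S = {a, y} := by
      ext x
      constructor
      · intro hx
        by_contra hcon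
        simp only [Set.mem_insert_iff, Set.mem_singleton_iff, not_or] at hcon
        rcases hpair x hx y hy hcon.2 hcon.1 hya with ⟨rfl, -⟩ | ⟨rfl, -⟩ <;> contradiction
      · rintro (rfl | rfl) <;> assumption
    have hyp : y ≠ p := by rintro rfl; exact hpS hy
    have hyq : y ≠ q := by rintro rfl; exact hqS hy
    have hconn : (F.induce Sᶜ).Connected := by
      refine connected_induce_of_subset
        (hK.connected_of_contract {y} (by rw [Set.ncard_singleton])) ?_ ?_
      · rw [hSe]
        intro z
        simp only [Set.mem_compl_iff, Set.mem_union, Set.mem_insert_iff, Set.mem_singleton_iff]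
        tauto
      · intro x hx hx'
        rw [hSe] at hx
        have h2 : ({a, y} : Set V).ncard = 2 := Set.ncard_pair hya.symm
        have hx2 : x = p ∨ x = q := by
          simp only [Set.mem_compl_iff, Set.mem_union, Set.mem_insert_iff,
            Set.mem_singleton_iff] at hx hx'
          tauto
        rcases hx2 with rfl | rfl
        · obtain ⟨z, hz, hz'⟩ := exists_adj_notMem (F := F) (v := x) (S := {a, y}) (by omega)
          refine ⟨z, ?_, hz⟩
          have h3 := hz.ne
          simp only [Set.mem_compl_iff, Set.mem_union, Set.mem_insert_iff,
            Set.mem_singleton_iff] at hz' ⊢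
          grind
        · obtain ⟨z, hz, hz'⟩ := exists_adj_notMem (F := F) (v := x) (S := {a, y}) (by omega)
          refine ⟨z, ?_, hz⟩
          have h3 := hz.ne
          have h4 := hz.symm
          simp only [Set.mem_compl_iff, Set.mem_union, Set.mem_insert_iff,
            Set.mem_singleton_iff] at hz' ⊢
          grind
    have hsub := hconn.preconnected.subsingleton_connectedComponent
    have h1 : (F.induce Sᶜ).oddComponents.ncard ≤ 1 := Set.ncard_le_one_of_subsingleton _
    rw [hS.2] at h1
    omega
  have hsub : S ⊆ {p, q} := by
    intro x hx
    obtain ⟨y, hy, hyx⟩ := exists_ne_of_one_lt_ncard hS1 x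
    rcases hpair x hx y hy hyx.symm (by rintro rfl; exact haS hx) (by rintro rfl; exact haS hy)
      with ⟨h, -⟩ | ⟨h, -⟩
    · exact Or.inl h
    · exact Or.inr h
  exact Set.eq_of_subset_of_ncard_le hsub (by rw [Set.ncard_pair hpq]; omega) (Set.toFinite _)

end barrier

/-! ### The index and the number of cubic ends -/

section index

variable [Finite V] {G : SimpleGraph V} {R : Set (Sym2 V)}

lemma exists_maximal_isBarrier {F : SimpleGraph V} {S : Set V} (hS : IsBarrier F S) :
    ∃ T, S ⊆ T ∧ Maximal (IsBarrier F) T :=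
  (Set.toFinite {S | IsBarrier F S}).exists_le_maximal hS

/-- The properties of an `R`-thin edge with exactly one cubic end. -/
lemma IsRThin.contract_isBrick (hG : IsRBrick G R) {a b p q : V} (he : IsRThin G R s(a, b))
    (hb : deg G b ≠ 3) (hN : ∀ z, G.Adj a z ↔ z = b ∨ z = p ∨ z = q)
    (hbp : b ≠ p) (hbq : b ≠ q) (hpq : p ≠ q) :
    ¬ G.Adj p q ∧ IsBrick (contract (G.deleteEdges {s(a, b)}) a p q) := by
  have hab : G.Adj a b := (hN b).2 (Or.inl rfl)
  have h1 := (isMultiBrick_retract_iff (adj_deleteEdges_iff hN hbp hbq) hpq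
    (fun v hv ↦ hG.isBrick.eq_of_deg_deleteEdges_eq_two hab hb hv)).1 he.2
  refine ⟨fun h ↦ h1.1 (deleteEdges_singleton_adj.2 ⟨h, ?_, ?_⟩), h1.2⟩
  · exact fun h' ↦ hbq h'.2.symm
  · exact fun h' ↦ hbp h'.1.symm

lemma isRThin_of_contract (hG : IsRBrick G R) {a b p q : V} (he : IsRCompatible G R s(a, b))
    (hb : deg G b ≠ 3) (hN : ∀ z, G.Adj a z ↔ z = b ∨ z = p ∨ z = q)
    (hbp : b ≠ p) (hbq : b ≠ q) (hpq : p ≠ q) (hpq' : ¬ G.Adj p q)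
    (hK : IsBrick (contract (G.deleteEdges {s(a, b)}) a p q)) : IsRThin G R s(a, b) := by
  have hab : G.Adj a b := (hN b).2 (Or.inl rfl)
  exact ⟨he, (isMultiBrick_retract_iff (adj_deleteEdges_iff hN hbp hbq) hpq
    (fun v hv ↦ hG.isBrick.eq_of_deg_deleteEdges_eq_two hab hb hv)).2
      ⟨fun h ↦ hpq' (SimpleGraph.deleteEdges_le _ h), hK⟩⟩

/-- The other two neighbours of the cubic end form a barrier, and `IsBarrier.eq_pair` leaves no
other nontrivial one. -/
lemma IsRThin.index_eq_one (hG : IsRBrick G R) {a b : V} (he : IsRThin G R s(a, b))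
    (ha : deg G a = 3) (hb : deg G b ≠ 3) : index G s(a, b) = 1 := by
  have hab : G.Adj a b := he.1.1.1
  obtain ⟨p, q, hbp, hbq, hpq, hN⟩ := exists_neighbors_of_deg_eq_three ha hab
  obtain ⟨hpq', hK⟩ := he.contract_isBrick hG hb hN hbp hbq hpq
  have hNe := adj_deleteEdges_iff hN hbp hbq
  have hmc := he.1.1.2
  have hdeg : ∀ v, v ≠ a → v ≠ b → 3 ≤ deg (G.deleteEdges {s(a, b)}) v := fun v h1 h2 ↦ by
    rw [deg_deleteEdges_of_ne h1 h2]; exact hG.isBrick.three_le_deg v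
  have hap := ((hN p).2 (by tauto)).ne
  have haq := ((hN q).2 (by tauto)).ne
  have key : ∀ S, IsBarrier (G.deleteEdges {s(a, b)}) S → 1 < S.ncard → S = {p, q} :=
    fun S hS hS1 ↦ hS.eq_pair hmc hNe hpq (fun h ↦ hpq' (SimpleGraph.deleteEdges_le _ h)) hK
      (hdeg p hap.symm hbp.symm) (hdeg q haq.symm hbq.symm) hS1
  have hbar := isBarrier_neighbors hNe hpq (matchable_univ.2 hmc.exists_mating) hG.even_card
  unfold index
  rw [Set.ncard_eq_one]
  refine ⟨{p, q}, ?_⟩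
  ext S
  simp only [Set.mem_ofPred_eq, Set.mem_singleton_iff]
  constructor
  · exact fun h ↦ key S h.1.1 h.2
  · rintro rfl
    refine ⟨⟨hbar, fun T hT hle ↦ ?_⟩, by rw [Set.ncard_pair hpq]; omega⟩
    have h1 := Set.ncard_le_ncard hle (Set.toFinite _)
    rw [Set.ncard_pair hpq] at h1
    exact (key T hT (by omega)).le

lemma IsRThin.index_eq_zero (hG : IsRBrick G R) {a b : V} (he : IsRThin G R s(a, b))
    (ha : deg G a ≠ 3) (hb : deg G b ≠ 3) : index G s(a, b) = 0 := by
  have hab : G.Adj a b := he.1.1.1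
  have hB := (isMultiBrick_retract_iff_of_forall_deg
    (fun v ↦ hG.isBrick.deg_deleteEdges_ne_two hab ha hb)).1 he.2
  unfold index
  rw [Set.ncard_eq_zero]
  ext S
  simp only [Set.mem_ofPred_eq, Set.mem_empty_iff_false, iff_false]
  rintro ⟨hS, hS1⟩
  obtain ⟨x, hx⟩ := hS.1.1
  obtain ⟨y, hy, hyx⟩ := exists_ne_of_one_lt_ncard hS1 x
  exact hS.1.not_matchable hy hx hyx (hB.matchable hyx)

/-- The neighbours of `a` and those of `b` in `G - e` form two barriers in opposite colour classes.
A common maximal barrier would contain one vertex of each class, but `H - e` has a perfect matching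
after deleting any such pair. -/
lemma IsRThin.index_ne_one (hG : IsRBrick G R) {a b : V} (he : IsRThin G R s(a, b))
    (ha : deg G a = 3) (hb : deg G b = 3) : index G s(a, b) ≠ 1 := by
  intro hi
  have hab : G.Adj a b := he.1.1.1
  obtain ⟨p, q, hbp, hbq, hpq, hN⟩ := exists_neighbors_of_deg_eq_three ha hab
  obtain ⟨r, s, har, has, hrs, hN'⟩ := exists_neighbors_of_deg_eq_three hb hab.symm
  have hmc := he.1.1.2
  have hM := matchable_univ.2 hmc.exists_mating
  have hbar := isBarrier_neighbors (adj_deleteEdges_iff hN hbp hbq) hpq hM hG.even_card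
  have hbar' := isBarrier_neighbors (adj_deleteEdges_iff hN' har has) hrs
    (by rwa [Sym2.eq_swap]) hG.even_card
  rw [Sym2.eq_swap] at hbar'
  obtain ⟨S, hS, hSm⟩ := exists_maximal_isBarrier hbar
  obtain ⟨T, hT, hTm⟩ := exists_maximal_isBarrier hbar'
  have hcard : ∀ {x y : V} {U : Set V}, x ≠ y → {x, y} ⊆ U → 1 < U.ncard := fun hxy hU ↦ by
    have := Set.ncard_le_ncard hU (Set.toFinite _)
    rw [Set.ncard_pair hxy] at this
    omega
  obtain ⟨U, hU⟩ := Set.ncard_eq_one.1 hi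
  have h1 : S = U := by
    have : S ∈ ({U} : Set (Set V)) := hU ▸ ⟨hSm, hcard hpq hS⟩
    exact this
  have h2 : T = U := by
    have : T ∈ ({U} : Set (Set V)) := hU ▸ ⟨hTm, hcard hrs hT⟩
    exact this
  obtain ⟨A, haA, hA⟩ := exists_isSide hG.isRemovableDoubleton.isBipartite a
  have haR := he.1.notMem_ends hG ha
  have hbR := (isRCompatible_swap.1 he.1).notMem_ends hG hb
  have hpA := hA.notMem haA (adj_deleteEdges_of_notMem_ends haR ((hN p).2 (by tauto)))
  have hbA := hA.notMem haA he.1.adj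
  have hrA := hA.mem hbA (adj_deleteEdges_of_notMem_ends hbR ((hN' r).2 (by tauto)))
  have hrp : r ≠ p := by rintro rfl; exact hpA hrA
  have hmat := he.1.2.2.matchable_of_isSide (hA.anti (SimpleGraph.deleteEdges_le _)) hrA hpA
  refine hSm.1.not_matchable (x := r) (y := p) ?_ (hS (by simp)) hrp
    (hmat.mono (SimpleGraph.deleteEdges_mono (SimpleGraph.deleteEdges_le _)))
  rw [h1, ← h2]
  exact hT (by simp)

/-- An `R`-thin edge of index one has exactly one cubic end. -/
lemma IsRThin.exists_cubic_end (hG : IsRBrick G R) {e : Sym2 V} (he : IsRThin G R e)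
    (hi : index G e = 1) : ∃ a b, e = s(a, b) ∧ deg G a = 3 ∧ deg G b ≠ 3 := by
  induction e with | h a b => ?_
  by_cases ha : deg G a = 3 <;> by_cases hb : deg G b = 3
  · exact absurd hi (he.index_ne_one hG ha hb)
  · exact ⟨a, b, rfl, ha, hb⟩
  · exact ⟨b, a, Sym2.eq_swap, hb, ha⟩
  · rw [he.index_eq_zero hG ha hb] at hi; omega

end index

/-! ### The 4-cycle at an `R`-thin edge of index one -/

section fourCycle

variable [Finite V] {G : SimpleGraph V} {R : Set (Sym2 V)}

lemma IsRBrick.adj_of_mem_of_notMem (hG : IsRBrick G R) {A : Set V}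
    (hA : IsSide (G.deleteEdges R) A) {x y : V} (hx : x ∈ A) (hy : y ∉ A) (hxy : G.Adj x y) :
    (G.deleteEdges R).Adj x y := by
  obtain ⟨a₁, h1, a₂, h2, b₁, h3, b₂, h4, rfl⟩ := hG.exists_eq_pair hA
  refine SimpleGraph.deleteEdges_adj.2 ⟨hxy, ?_⟩
  simp only [Set.mem_insert_iff, Set.mem_singleton_iff, Sym2.eq_iff]
  grind

/-- The two edges of `R` lie in different colour classes and so are disjoint. -/
lemma IsRBrick.mate_unique (hG : IsRBrick G R) {x y z : V} (hy : s(x, y) ∈ R)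
    (hz : s(x, z) ∈ R) : y = z := by
  obtain ⟨A, hxA, hA⟩ := exists_isSide hG.isRemovableDoubleton.isBipartite x
  obtain ⟨a₁, h1, a₂, h2, b₁, h3, b₂, h4, rfl⟩ := hG.exists_eq_pair hA
  simp only [Set.mem_insert_iff, Set.mem_singleton_iff, Sym2.eq_iff] at hy hz
  grind

/-- Deleting the edge `pc` from a brick `G` leaves a brick if `G - ab` contracts to a brick in which
`pc` is a multiple edge and `p` is not cubic. -/
lemma IsRBrick.isBrick_deleteEdges (hG : IsRBrick G R) {a b p q c : V}
    (hN : ∀ z, G.Adj a z ↔ z = b ∨ z = p ∨ z = q) (hbp : b ≠ p) (hbq : b ≠ q) (hpq : p ≠ q)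
    (hac : a ≠ c) (hpc : G.Adj p c) (hqc : G.Adj q c) (hpq' : ¬ G.Adj p q)
    (hK : IsBrick (contract (G.deleteEdges {s(a, b)}) a p q)) (hp : 3 < deg G p)
    {A : Set V} (haA : a ∈ A) (hpA : p ∉ A) (hqA : q ∉ A) (hA : IsSide (G.deleteEdges R) A)
    (hf : IsRCompatible G R s(p, c)) :
    IsBrick (G.deleteEdges {s(p, c)}) := by
  have hab := (hN b).2 (by tauto)
  have hap := (hN p).2 (by tauto)
  have haq := (hN q).2 (by tauto)
  set G' := G.deleteEdges {s(p, c)} with hG'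
  set F := (G.deleteEdges {s(a, b)}).deleteEdges {s(p, c)} with hF
  have hadj : ∀ u v, G.Adj u v → ¬ (u = p ∧ v = c) → ¬ (u = c ∧ v = p) → G'.Adj u v :=
    fun u v h h1 h2 ↦ deleteEdges_singleton_adj.2 ⟨h, h1, h2⟩
  have hle : F ≤ G' := SimpleGraph.deleteEdges_mono (SimpleGraph.deleteEdges_le _)
  have hFap : F.Adj a p := by
    rw [hF, deleteEdges_singleton_adj, deleteEdges_singleton_adj]
    have := hap.ne; have := hab.ne
    exact ⟨⟨hap, by tauto, by tauto⟩, by tauto, by tauto⟩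
  have hFaq : F.Adj a q := by
    rw [hF, deleteEdges_singleton_adj, deleteEdges_singleton_adj]
    have := hap.ne; have := hab.ne
    exact ⟨⟨haq, by tauto, by tauto⟩, by tauto, by tauto⟩
  have hFqc : F.Adj q c := by
    rw [hF, deleteEdges_singleton_adj, deleteEdges_singleton_adj]
    have := haq.ne
    exact ⟨⟨hqc, by tauto, by grind⟩, by grind, by have := hqc.ne; tauto⟩
  -- In the contraction `pc` is parallel to `qc`, so deleting it changes no adjacency.
  have hKF : IsBrick (contract F a p q) := by
    refine hK.of_equiv (Equiv.refl _) ?_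
    rintro x y ⟨hxy, h⟩
    have hx := x.2
    have hy := y.2
    refine ⟨hxy, ?_⟩
    simp only [Equiv.refl_apply]
    have hcon : ∀ z : V, (G.deleteEdges {s(a, b)}).Adj p z → z ≠ c → F.Adj p z := fun z hz hzc ↦ by
      rw [hF, deleteEdges_singleton_adj]
      exact ⟨hz, by tauto, by have := hpc.ne; tauto⟩
    rcases h with h | ⟨h, h'⟩ | ⟨h, h'⟩
    · left
      rw [hF, deleteEdges_singleton_adj]
      exact ⟨h, by tauto, by tauto⟩
    · by_cases hyc : y.1 = c
      · left; rw [h, hyc]; exact hFqc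
      · exact Or.inr (Or.inl ⟨h, hcon _ h' hyc⟩)
    · by_cases hxc : x.1 = c
      · left; rw [h, hxc]; exact hFqc.symm
      · exact Or.inr (Or.inr ⟨h, (hcon _ h'.symm hxc).symm⟩)
  have h3 : IsThreeConnected G' := by
    refine ⟨hG.isBrick.threeConnected.four_le_card, fun X hX ↦ ?_⟩
    have hGX := hG.isBrick.threeConnected.connected_compl X hX
    by_cases hpX : p ∈ X
    · refine connected_induce_of_adj hGX fun u hu v hv huv ↦ hadj u v huv ?_ ?_
      · rintro ⟨rfl, -⟩; exact hu hpX
      · rintro ⟨-, rfl⟩; exact hv hpX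
    by_cases hcX : c ∈ X
    · refine connected_induce_of_adj hGX fun u hu v hv huv ↦ hadj u v huv ?_ ?_
      · rintro ⟨-, rfl⟩; exact hv hcX
      · rintro ⟨rfl, -⟩; exact hu hcX
    -- If `X` misses the whole 4-cycle, the path `p a q c` replaces `pc`. Otherwise `X` has at most
    -- one vertex outside `{a, p, q}`, so the remainder is connected by the contraction, and the
    -- surviving vertices among `q`, `p`, `a` are reattached.
    by_cases haqX : a ∈ X ∨ q ∈ X
    swap
    · push Not at haqX
      refine connected_induce_of_root (c := p) hpX fun T hpT hcl ↦ ?_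
      refine mem_of_connected hGX (x := p) hpX hpT fun u hu huT v hv huv ↦ ?_
      have haT := hcl p hpX hpT a haqX.1 (hle hFap.symm)
      have hqT := hcl a haqX.1 haT q haqX.2 (hle hFaq)
      have hcT := hcl q haqX.2 hqT c hcX (hle hFqc)
      by_cases h1 : u = p ∧ v = c
      · rw [h1.2]; exact hcT
      by_cases h2 : u = c ∧ v = p
      · rw [h2.2]; exact hpT
      exact hcl u hu huT v hv (hadj u v huv h1 h2)
    · set Y := X \ {a, p, q} with hY
      have hYcard : Y.ncard ≤ 1 := by
        have key : ∀ w ∈ X, w ∈ ({a, p, q} : Set V) → Y.ncard ≤ 1 := fun w hw hw' ↦ by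
          have h1 : Y ⊆ X \ {w} := fun z hz ↦ ⟨hz.1, by rintro rfl; exact hz.2 hw'⟩
          have h2 := Set.ncard_le_ncard h1 (Set.toFinite _)
          rw [Set.ncard_sdiff_singleton_of_mem hw] at h2
          omega
        rcases haqX with h | h
        · exact key a h (by simp)
        · exact key q h (by simp)
      have hS := hKF.connected_of_contract Y hYcard
      have hS' := connected_induce_of_adj hS (F' := G') fun u _ v _ huv ↦ hle huv
      have hmem : ∀ z, z ∈ ({a, p, q} ∪ Y)ᶜ ↔ z ≠ a ∧ z ≠ p ∧ z ≠ q ∧ z ∉ X := by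
        intro z
        simp only [hY, Set.mem_compl_iff, Set.mem_union, Set.mem_insert_iff,
          Set.mem_singleton_iff, Set.mem_sdiff]
        tauto
      have hS2 : (G'.induce (Xᶜ \ {a})).Connected := by
        refine connected_induce_of_subset hS' (fun z hz ↦ ?_) fun x hx hx' ↦ ?_
        · have := (hmem z).1 hz
          exact ⟨this.2.2.2, this.1⟩
        · rw [hmem] at hx'
          have hx2 : x = p ∨ x = q := by
            have h1 := hx.1
            have h2 := hx.2
            simp only [Set.mem_compl_iff, Set.mem_singleton_iff] at h1 h2
            tauto
          rcases hx2 with rfl | rfl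
          -- This is where `p` must be noncubic: it needs a neighbour besides `a`, `c` and the at
          -- most one vertex of `Y`.
          · have hcard : ({a, c} ∪ Y : Set V).ncard ≤ 3 := by
              have h1 := Set.ncard_union_le {a, c} Y
              have h2 := Set.ncard_pair hac
              omega
            obtain ⟨z, hz, hz'⟩ := exists_adj_notMem (F := G) (v := x) (S := {a, c} ∪ Y)
              (by omega)
            simp only [hY, Set.mem_union, Set.mem_insert_iff, Set.mem_singleton_iff,
              Set.mem_sdiff] at hz'
            have h4 := hz.ne
            have h5 : z ≠ q := by rintro rfl; exact hpq' hz
            have hza : z ≠ a := fun h ↦ hz' (Or.inl (Or.inl h))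
            have hzX : z ∉ X := fun h ↦ hz' (Or.inr ⟨h, by
              rintro (h | h | h)
              · exact hza h
              · exact h4 h.symm
              · exact h5 h⟩)
            exact ⟨z, (hmem z).2 ⟨hza, h4.symm, h5, hzX⟩,
              hadj _ _ hz (fun h ↦ hz' (Or.inl (Or.inr h.2))) (fun h ↦ hpc.ne h.1)⟩
          · exact ⟨c, (hmem c).2 ⟨hac.symm, hpc.ne.symm, hqc.ne.symm, hcX⟩, hle hFqc⟩
      refine connected_induce_of_subset hS2 Set.sdiff_subset fun x hx hx' ↦ ?_
      have hxa : x = a := by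
        by_contra h
        exact hx' ⟨hx, h⟩
      exact ⟨p, ⟨hpX, hap.ne.symm⟩, hxa ▸ hle hFap⟩
  have key : ∀ x y, x ≠ a → y ≠ a → x ≠ y → ¬ (x = p ∧ y = q) → ¬ (x = q ∧ y = p) →
      Matchable G' {x, y}ᶜ := fun x y hx hy hxy h1 h2 ↦
    (hKF.matchable_of_contract hFap hFaq hpq hx hy hxy h1 h2).mono hle
  -- For `y` in the class opposite to `a`, a matching of `H - pc` suffices. For `y` in the class of
  -- `a`, Tutte's theorem transfers the property from the pairs `{x, y}` with `x ≠ a`, none of which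
  -- is `{p, q}`.
  have keya : ∀ y, y ≠ a → Matchable G' {a, y}ᶜ := by
    intro y hy
    by_cases hyA : y ∈ A
    · refine matchable_of_connected_compl hy.symm hG.even_card
        (h3.connected_compl _ (Set.ncard_pair hy.symm).le) fun x hxa hxy ↦ ?_
      refine key x y hxa hy hxy ?_ ?_
      · rintro ⟨-, rfl⟩; exact hqA hyA
      · rintro ⟨-, rfl⟩; exact hpA hyA
    · exact (hf.2.2.matchable_of_isSide (hA.anti (SimpleGraph.deleteEdges_le _)) haA hyA).mono
        (SimpleGraph.deleteEdges_mono (SimpleGraph.deleteEdges_le _))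
  -- The contraction cannot supply this pair, but the restored edge `ab` can cover `a`.
  have keypq : Matchable G' {p, q}ᶜ := by
    refine ((hKF.matchable_compl_four haq.ne.symm hpq.symm hab.ne.symm hbp hbq).mono
      hle).add_edge (hadj a b hab ?_ ?_) (by simp) (by simp) ?_
    · have := hap.ne; tauto
    · tauto
    · have := hap.ne
      have := haq.ne
      ext z; simp only [Set.mem_compl_iff, Set.mem_insert_iff, Set.mem_singleton_iff,
        Set.mem_union]
      grind
  refine ⟨h3, fun u v huv ↦ hasPerfectMatching_induce_iff.2 ?_⟩
  by_cases hua : u = a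
  · subst hua; exact keya v huv.symm
  by_cases hva : v = a
  · subst hva; rw [Set.pair_comm]; exact keya u huv
  by_cases h1 : u = p ∧ v = q
  · rw [h1.1, h1.2]; exact keypq
  by_cases h2 : u = q ∧ v = p
  · rw [h2.1, h2.2, Set.pair_comm]; exact keypq
  exact key u v hua hva huv h1 h2

/-- An `R`-thin edge with exactly one cubic end which is not strictly `R`-thin yields a 4-cycle
containing the cubic end, in which the opposite vertex is not cubic. -/
lemma IsRThin.exists_fourCycle (hG : IsRBrick G R) {a b p q : V} (he : IsRThin G R s(a, b))
    (hs : ¬ IsStrictlyRThin G R s(a, b)) (ha : deg G a = 3) (hb : deg G b ≠ 3)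
    (hN : ∀ z, G.Adj a z ↔ z = b ∨ z = p ∨ z = q) (hbp : b ≠ p) (hbq : b ≠ q) (hpq : p ≠ q) :
    ∃ c, c ≠ a ∧ (G.deleteEdges R).Adj p c ∧ (G.deleteEdges R).Adj q c ∧ deg G c ≠ 3 := by
  have hab : G.Adj a b := (hN b).2 (by tauto)
  have hap : G.Adj a p := (hN p).2 (by tauto)
  have haq : G.Adj a q := (hN q).2 (by tauto)
  obtain ⟨hpq', hK⟩ := he.contract_isBrick hG hb hN hbp hbq hpq
  obtain ⟨c, hca, hpc, hqc⟩ := exists_common_neighbor_of_not_simple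
    (adj_deleteEdges_iff hN hbp hbq) hpq
    (fun v hv ↦ hG.isBrick.eq_of_deg_deleteEdges_eq_two hab hb hv) he.2.1 (fun h ↦ hs ⟨he, h⟩)
  replace hpc := SimpleGraph.deleteEdges_le _ hpc
  replace hqc := SimpleGraph.deleteEdges_le _ hqc
  obtain ⟨A, haA, hA⟩ := exists_isSide hG.isRemovableDoubleton.isBipartite a
  have haR := he.1.notMem_ends hG ha
  have hpA := hA.notMem haA (adj_deleteEdges_of_notMem_ends haR hap)
  have hqA := hA.notMem haA (adj_deleteEdges_of_notMem_ends haR haq)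
  -- Otherwise `pc` and `qc` would join vertices of one colour class and both lie in `R`, whose
  -- edges are disjoint.
  have hcA : c ∈ A := by
    by_contra hcA
    have hR : ∀ x, x ∉ A → G.Adj x c → s(c, x) ∈ R := by
      intro x hx hxc
      by_contra h
      rw [Sym2.eq_swap] at h
      exact hcA (hA.mem hx (SimpleGraph.deleteEdges_adj.2 ⟨hxc, h⟩))
    exact hpq (hG.mate_unique (hR p hpA hpc) (hR q hqA hqc))
  refine ⟨c, hca, (hG.adj_of_mem_of_notMem hA hcA hpA hpc.symm).symm,
    (hG.adj_of_mem_of_notMem hA hcA hqA hqc.symm).symm, fun hc ↦ ?_⟩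
  obtain ⟨q', z, hpq1, hpz, hqz, hNc⟩ := exists_neighbors_of_deg_eq_three hc hpc.symm
  have hqz' : ∃ z, c ≠ z ∧ ∀ w, G.Adj c w → w = p ∨ w = q ∨ w = z := by
    rcases (hNc q).1 hqc.symm with h | h | h
    · exact absurd h.symm hpq
    · exact ⟨z, ((hNc z).2 (by tauto)).ne, fun w hw ↦ by rw [h]; exact (hNc w).1 hw⟩
    · exact ⟨q', ((hNc q').2 (by tauto)).ne, fun w hw ↦ by
        rw [h]; have := (hNc w).1 hw; tauto⟩
  obtain ⟨z, hcz, hNz⟩ := hqz'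
  -- A cubic `c` would have at most two neighbours in the contraction, the merged vertex and `z`.
  -- Deleting these isolates `c`, leaving at most three vertices in the contraction.
  have h1 := hK.connected_of_contract {z} (by rw [Set.ncard_singleton])
  have h2 := mem_of_connected h1 (x := c) (T := {c})
    (by simp [hca, hpc.ne.symm, hqc.ne.symm, hcz]) rfl (by
      rintro u _ rfl v hv huv
      have := hNz v (SimpleGraph.deleteEdges_le _ huv)
      simp only [Set.mem_compl_iff, Set.mem_union, Set.mem_insert_iff,
        Set.mem_singleton_iff] at hv
      tauto)
  have h3 : ({a, p}ᶜ : Set V) ⊆ {q, z, c} := by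
    intro w hw
    by_cases hw' : w ∈ ({a, p, q} ∪ {z} : Set V)ᶜ
    · have := h2 hw'
      simp only [Set.mem_singleton_iff] at this
      simp [this]
    · simp only [Set.mem_compl_iff, Set.mem_union, Set.mem_insert_iff,
        Set.mem_singleton_iff] at hw hw' ⊢
      tauto
  have h4 := Set.ncard_le_ncard h3 (Set.toFinite _)
  have h5 := Set.ncard_insert_le q {z, c}
  have h6 := Set.ncard_insert_le z {c}
  rw [Set.ncard_singleton] at h6
  have h7 := hK.threeConnected.four_le_card
  have h8 : ({a, p}ᶜ : Set V) = {x | x ≠ a ∧ x ≠ p} := by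
    ext; simp
  rw [h8] at h4
  have h9 : Nat.card {x // x ≠ a ∧ x ≠ p} = ({x | x ≠ a ∧ x ≠ p} : Set V).ncard := rfl
  omega

/-- For edges of `H`, admissibility comes from `H - pc`. An edge of `R` is neither `pc` nor `aq`, so
it survives the 4-cycle switch applied to a perfect matching of `G - ab`. -/
lemma IsRCompatible.of_fourCycle (hG : IsRBrick G R) {a b p q c d : V}
    (he : IsRCompatible G R s(a, b)) (ha : deg G a = 3)
    (hN : ∀ z, G.Adj a z ↔ z = b ∨ z = p ∨ z = q) (hbp : b ≠ p) (hbq : b ≠ q) (hpq : p ≠ q)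
    (hca : c ≠ a) (hpc : (G.deleteEdges R).Adj p c) (hqc : (G.deleteEdges R).Adj q c)
    (hda : d ≠ a) (hdc : d ≠ c) (hpd : (G.deleteEdges R).Adj p d) :
    IsRCompatible G R s(p, c) := by
  have haR := he.notMem_ends hG ha
  have hle : G.deleteEdges R ≤ G := SimpleGraph.deleteEdges_le _
  obtain ⟨A, haA, hA⟩ := exists_isSide hG.isRemovableDoubleton.isBipartite a
  have hNH : ∀ z, (G.deleteEdges R).Adj a z ↔ z = b ∨ z = p ∨ z = q := fun z ↦ by
    rw [← hN]; exact ⟨fun h ↦ hle h, adj_deleteEdges_of_notMem_ends haR⟩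
  have hap := (hN p).2 (by tauto)
  have haq := (hN q).2 (by tauto)
  have hH := hG.isRemovableDoubleton.isMatchingCovered.deleteEdges_of_fourCycle hA haA he.2.2 hNH
    hbp hbq hpq hca.symm hpc hqc.symm hda hdc hpd
  have hNe := adj_deleteEdges_iff hN hbp hbq
  refine ⟨⟨hle hpc, hH.two_le_card, ?_, fun g hg ↦ ?_⟩, hpc, hH⟩
  · have h1 := hH.connected
    exact h1.mono (SimpleGraph.deleteEdges_mono hle)
  · induction g with | h x y => ?_
    have hxy := SimpleGraph.deleteEdges_adj.1 hg
    rw [isAdmissible_iff]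
    by_cases hR : s(x, y) ∈ R
    · have hnotR : ∀ u v, (G.deleteEdges R).Adj u v → s(x, y) ≠ s(u, v) := fun u v huv h ↦ by
        rw [SimpleGraph.deleteEdges_adj] at huv
        exact huv.2 (h ▸ hR)
      have hxye : (G.deleteEdges {s(a, b)}).Adj x y :=
        SimpleGraph.deleteEdges_adj.2 ⟨hxy.1, hnotR a b he.adj⟩
      have hcqe : (G.deleteEdges {s(a, b)}).Adj c q := by
        rw [deleteEdges_singleton_adj]
        exact ⟨(hle hqc).symm, by tauto, by have := haq.ne; tauto⟩
      obtain ⟨m, hm, hmx⟩ := he.1.2.exists_isMating hxye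
      obtain ⟨m', hm', h⟩ := hm.exists_avoiding hNe hcqe hca.symm hpq hmx (hnotR p c hpc)
        (hnotR a q ((hNH q).2 (by tauto)))
      have hle' : (G.deleteEdges {s(a, b)}).deleteEdges {s(p, c)} ≤ G.deleteEdges {s(p, c)} :=
        SimpleGraph.deleteEdges_mono (SimpleGraph.deleteEdges_le _)
      exact ⟨m', fun z ↦ ⟨(hm' z).1, hle' (hm' z).2⟩, h⟩
    · have hxyH : ((G.deleteEdges R).deleteEdges {s(p, c)}).Adj x y := by
        rw [SimpleGraph.deleteEdges_adj, SimpleGraph.deleteEdges_adj]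
        exact ⟨⟨hxy.1, hR⟩, hxy.2⟩
      obtain ⟨m, hm, hmx⟩ := hH.exists_isMating hxyH
      have hle' : (G.deleteEdges R).deleteEdges {s(p, c)} ≤ G.deleteEdges {s(p, c)} :=
        SimpleGraph.deleteEdges_mono hle
      exact ⟨m, fun z ↦ ⟨(hm z).1, hle' (hm z).2⟩, hmx⟩

/-- In the 4-cycle of `IsRThin.exists_fourCycle`, the neighbours of the cubic end are cubic. -/
lemma IsRThin.deg_eq_three (hG : IsRBrick G R) (hfree : ∀ f : Sym2 V, ¬ IsStrictlyRThin G R f)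
    {a b p q c : V} (he : IsRThin G R s(a, b)) (ha : deg G a = 3) (hb : deg G b ≠ 3)
    (hN : ∀ z, G.Adj a z ↔ z = b ∨ z = p ∨ z = q) (hbp : b ≠ p) (hbq : b ≠ q) (hpq : p ≠ q)
    (hca : c ≠ a) (hpc : (G.deleteEdges R).Adj p c) (hqc : (G.deleteEdges R).Adj q c)
    (hc : deg G c ≠ 3) : deg G p = 3 := by
  by_contra hp
  have hp3 := hG.isBrick.three_le_deg p
  have hle : G.deleteEdges R ≤ G := SimpleGraph.deleteEdges_le _
  obtain ⟨r, hr⟩ : ∃ r, ∀ d, s(p, d) ∈ R → d = r := by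
    by_cases h : ∃ r, s(p, r) ∈ R
    · obtain ⟨r, hr⟩ := h
      exact ⟨r, fun d hd ↦ hG.mate_unique hd hr⟩
    · push Not at h
      exact ⟨p, fun d hd ↦ absurd hd (h d)⟩
  obtain ⟨d, hpd, hd⟩ := exists_adj_notMem (F := G) (v := p) (S := {a, c, r}) (by
    have h1 := Set.ncard_insert_le a {c, r}
    have h2 := Set.ncard_insert_le c {r}
    rw [Set.ncard_singleton] at h2
    omega)
  simp only [Set.mem_insert_iff, Set.mem_singleton_iff, not_or] at hd
  have hpd' : (G.deleteEdges R).Adj p d :=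
    SimpleGraph.deleteEdges_adj.2 ⟨hpd, fun h ↦ hd.2.2 (hr d h)⟩
  have hf := he.1.of_fourCycle hG ha hN hbp hbq hpq hca hpc hqc hd.1 hd.2.1 hpd'
  obtain ⟨hpq', hK⟩ := he.contract_isBrick hG hb hN hbp hbq hpq
  obtain ⟨A, haA, hA⟩ := exists_isSide hG.isRemovableDoubleton.isBipartite a
  have haR := he.1.notMem_ends hG ha
  have hpA := hA.notMem haA (adj_deleteEdges_of_notMem_ends haR ((hN p).2 (by tauto)))
  have hqA := hA.notMem haA (adj_deleteEdges_of_notMem_ends haR ((hN q).2 (by tauto)))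
  have hB := hG.isBrick_deleteEdges hN hbp hbq hpq hca.symm (hle hpc) (hle hqc) hpq' hK
    (by omega) haA hpA hqA hA hf
  -- Both `p` and `c` are noncubic, so nothing is contracted: the retract is `G - pc` itself, hence
  -- simple, and `pc` would be strictly `R`-thin.
  have hdeg : ∀ v, deg (G.deleteEdges {s(p, c)}) v ≠ 2 := fun v ↦
    hG.isBrick.deg_deleteEdges_ne_two (hle hpc) hp hc
  exact hfree s(p, c)
    ⟨⟨hf, (isMultiBrick_retract_iff_of_forall_deg hdeg).2 hB⟩, simple_retract_of_forall_deg hdeg⟩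

/-- In the 4-cycle of `IsRThin.exists_fourCycle`, the edge opposite to a cubic neighbour outside
`V(R)` is again `R`-thin of index one. -/
lemma IsRThin.of_fourCycle (hG : IsRBrick G R) {a b p q c : V} (he : IsRThin G R s(a, b))
    (ha : deg G a = 3) (hb : deg G b ≠ 3)
    (hN : ∀ z, G.Adj a z ↔ z = b ∨ z = p ∨ z = q) (hbp : b ≠ p) (hbq : b ≠ q) (hpq : p ≠ q)
    (hca : c ≠ a) (hpc : (G.deleteEdges R).Adj p c) (hqc : (G.deleteEdges R).Adj q c)
    (hc : deg G c ≠ 3) (hp : deg G p = 3) (hpR : p ∉ ends R) :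
    IsRThin G R s(p, c) ∧ index G s(p, c) = 1 := by
  have hle : G.deleteEdges R ≤ G := SimpleGraph.deleteEdges_le _
  have hap := (hN p).2 (by tauto)
  have haq := (hN q).2 (by tauto)
  obtain ⟨hpq', hK⟩ := he.contract_isBrick hG hb hN hbp hbq hpq
  obtain ⟨A, haA, hA⟩ := exists_isSide hG.isRemovableDoubleton.isBipartite a
  have haR := he.1.notMem_ends hG ha
  have hpA := hA.notMem haA (adj_deleteEdges_of_notMem_ends haR hap)
  have hqA := hA.notMem haA (adj_deleteEdges_of_notMem_ends haR haq)
  have hbA := hA.notMem haA he.1.adj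
  obtain ⟨d, hda, hdc, hNp⟩ : ∃ d, d ≠ a ∧ d ≠ c ∧ ∀ z, G.Adj p z ↔ z = c ∨ z = a ∨ z = d := by
    obtain ⟨x, y, hcx, hcy, hxy, h⟩ := exists_neighbors_of_deg_eq_three hp (hle hpc)
    rcases (h a).1 hap.symm with h1 | h1 | h1
    · exact absurd h1.symm hca
    · exact ⟨y, by rw [h1]; exact hxy.symm, hcy.symm, by rw [h1]; exact h⟩
    · exact ⟨x, by rw [h1]; exact hxy, hcx.symm, fun z ↦ by rw [h, h1]; tauto⟩
  have hpd := (hNp d).2 (by tauto)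
  have hpd' := adj_deleteEdges_of_notMem_ends hpR hpd
  have hdA := hA.mem hpA hpd'
  have hf := he.1.of_fourCycle hG ha hN hbp hbq hpq hca hpc hqc hda hdc hpd'
  have hne : ∀ {z}, z ∉ A → d ≠ z := fun hz h ↦ hz (h ▸ hdA)
  have had : ¬ G.Adj a d := fun h ↦ by
    rcases (hN d).1 h with h | h | h
    · exact hne hbA h
    · exact hne hpA h
    · exact hne hqA h
  -- Both contractions live on the vertices other than `a` and `p`: one names its merged vertex `q`,
  -- the other `d`. The identity preserves adjacency: an edge from the merged `q` via `p` goes to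
  -- `c`, already a neighbour of `q`, or to `d`, where the path `q a` replaces it.
  have hK' : IsBrick (contract (G.deleteEdges {s(p, c)}) p a d) := by
    refine hK.of_equiv (Equiv.subtypeEquivRight fun x ↦ and_comm) ?_
    rintro x y ⟨hxy, h⟩
    have key : ∀ u v : V, u ≠ a → v ≠ a → u = q → (G.deleteEdges {s(a, b)}).Adj p v → u ≠ v →
        (G.deleteEdges {s(p, c)}).Adj u v ∨ (v = d ∧ (G.deleteEdges {s(p, c)}).Adj u a) := by
      rintro u v hu hv rfl hpv huv
      rcases (hNp v).1 (SimpleGraph.deleteEdges_le _ hpv) with rfl | h | rfl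
      · left
        rw [deleteEdges_singleton_adj]
        exact ⟨hle hqc, fun h ↦ hpq h.1.symm, fun h ↦ hpc.ne h.2.symm⟩
      · exact absurd h hv
      · refine Or.inr ⟨rfl, ?_⟩
        rw [deleteEdges_singleton_adj]
        exact ⟨haq.symm, fun h ↦ hpq h.1.symm, fun h ↦ hap.ne h.2⟩
    refine ⟨(Equiv.injective _).ne hxy, ?_⟩
    simp only [Equiv.subtypeEquivRight_apply_coe]
    have hxy' : x.1 ≠ y.1 := fun h ↦ hxy (Subtype.ext h)
    rcases h with h | ⟨h, h'⟩ | ⟨h, h'⟩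
    · left
      rw [deleteEdges_singleton_adj]
      exact ⟨SimpleGraph.deleteEdges_le _ h, fun h ↦ x.2.2 h.1, fun h ↦ y.2.2 h.2⟩
    · rcases key x y x.2.1 y.2.1 h h' hxy' with h1 | h1
      · exact Or.inl h1
      · exact Or.inr (Or.inr h1)
    · rcases key y x y.2.1 x.2.1 h h'.symm hxy'.symm with h1 | h1
      · exact Or.inl h1.symm
      · exact Or.inr (Or.inl ⟨h1.1, h1.2.symm⟩)
  have hthin := isRThin_of_contract hG hf hc hNp hca hdc.symm hda.symm had hK'
  exact ⟨hthin, hthin.index_eq_one hG hp hc⟩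

/-- The local structure around an `R`-thin edge of index one. -/
lemma IsRThin.exists_neighbors (hG : IsRBrick G R)
    (hfree : ∀ f : Sym2 V, ¬ IsStrictlyRThin G R f) {a b : V} (he : IsRThin G R s(a, b))
    (ha : deg G a = 3) (hb : deg G b ≠ 3) :
    ∃ p q c, b ≠ p ∧ b ≠ q ∧ p ≠ q ∧ (∀ z, G.Adj a z ↔ z = b ∨ z = p ∨ z = q) ∧ c ≠ a ∧
      deg G c ≠ 3 ∧ ∀ x, x = p ∨ x = q → deg G x = 3 ∧ (G.deleteEdges R).Adj x c ∧
        (x ∈ ends R ∨ (IsRThin G R s(x, c) ∧ index G s(x, c) = 1)) := by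
  have hab : G.Adj a b := he.1.1.1
  obtain ⟨p, q, hbp, hbq, hpq, hN⟩ := exists_neighbors_of_deg_eq_three ha hab
  obtain ⟨c, hca, hpc, hqc, hc⟩ :=
    he.exists_fourCycle hG (hfree _) ha hb hN hbp hbq hpq
  refine ⟨p, q, c, hbp, hbq, hpq, hN, hca, hc, ?_⟩
  have hN' : ∀ z, G.Adj a z ↔ z = b ∨ z = q ∨ z = p := fun z ↦ by rw [hN]; tauto
  have hp := he.deg_eq_three hG hfree ha hb hN hbp hbq hpq hca hpc hqc hc
  have hq := he.deg_eq_three hG hfree ha hb hN' hbq hbp hpq.symm hca hqc hpc hc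
  rintro x (rfl | rfl)
  · refine ⟨hp, hpc, or_iff_not_imp_left.2 fun h ↦ ?_⟩
    exact he.of_fourCycle hG ha hb hN hbp hbq hpq hca hpc hqc hc hp h
  · refine ⟨hq, hqc, or_iff_not_imp_left.2 fun h ↦ ?_⟩
    exact he.of_fourCycle hG ha hb hN' hbq hbp hpq.symm hca hqc hpc hc hq h

end fourCycle

/-! ### Rim paths and their propagation -/

section rim

variable {G : SimpleGraph V} {R : Set (Sym2 V)}

/-- A cubic vertex joined to its hub, which lies in `V(R)` or whose spoke is `R`-thin of
index one. -/
structure IsRim (G : SimpleGraph V) (R : Set (Sym2 V)) (hub : V → V) (x : V) : Prop where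
  deg_eq : deg G x = 3
  adj : (G.deleteEdges R).Adj x (hub x)
  thin : x ∈ ends R ∨ (IsRThin G R s(x, hub x) ∧ index G s(x, hub x) = 1)

/-- A rim vertex outside `V(R)` whose other two neighbours are rim vertices. -/
structure IsInner (G : SimpleGraph V) (R : Set (Sym2 V)) (hub : V → V) (x : V) : Prop where
  isRim : IsRim G R hub x
  notMem : x ∉ ends R
  neighbors : ∃ p q, p ≠ q ∧ hub x ≠ p ∧ hub x ≠ q ∧
    (∀ z, G.Adj x z ↔ z = hub x ∨ z = p ∨ z = q) ∧ IsRim G R hub p ∧ IsRim G R hub q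

/-- A path `x 0, …, x k` of rim vertices, all internal vertices of which are inner, and which has
`a` as an internal vertex. -/
structure IsRimPath (G : SimpleGraph V) (R : Set (Sym2 V)) (hub : V → V) (a : V) (k : ℕ)
    (x : ℕ → V) : Prop where
  injOn : ∀ i ≤ k, ∀ j ≤ k, x i = x j → i = j
  adj : ∀ i < k, G.Adj (x i) (x (i + 1))
  rim : ∀ i ≤ k, IsRim G R hub (x i)
  inner : ∀ i, 0 < i → i < k → IsInner G R hub (x i)
  mem : ∃ i, 0 < i ∧ i < k ∧ x i = a

variable {hub : V → V} {a : V} {k : ℕ} {x : ℕ → V}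

lemma IsInner.thin {y : V} (h : IsInner G R hub y) :
    IsRThin G R s(y, hub y) ∧ index G s(y, hub y) = 1 := h.isRim.thin.resolve_left h.notMem

lemma IsRimPath.two_le (h : IsRimPath G R hub a k x) : 2 ≤ k := by
  obtain ⟨i, h1, h2, -⟩ := h.mem; omega

lemma IsRimPath.reverse (h : IsRimPath G R hub a k x) :
    IsRimPath G R hub a k (fun i ↦ x (k - i)) := by
  refine ⟨fun i hi j hj hij ↦ ?_, fun i hi ↦ ?_, fun i hi ↦ h.rim _ (by omega),
    fun i h1 h2 ↦ h.inner _ (by omega) (by omega), ?_⟩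
  · have := h.injOn _ (by omega) _ (by omega) hij
    omega
  · have h1 := h.adj (k - (i + 1)) (by omega)
    rw [show k - (i + 1) + 1 = k - i by omega] at h1
    exact h1.symm
  · obtain ⟨i, h1, h2, h3⟩ := h.mem
    exact ⟨k - i, by omega, by omega, by rw [show k - (k - i) = i by omega]; exact h3⟩

lemma IsRimPath.lt_card [Finite V] (h : IsRimPath G R hub a k x) : k < Nat.card V := by
  have h1 : Function.Injective (fun i : Fin (k + 1) ↦ x i) := fun i j hij ↦
    Fin.ext (h.injOn i (by omega) j (by omega) hij)
  have h2 := Nat.card_le_card_of_injective _ h1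
  rw [Nat.card_fin] at h2
  omega

lemma eq_of_adj_of_deg_eq_three {F : SimpleGraph V} {v x y z w : V} (hv : deg F v = 3)
    (hx : F.Adj v x) (hy : F.Adj v y) (hz : F.Adj v z) (hxy : x ≠ y) (hxz : x ≠ z) (hyz : y ≠ z)
    (hw : F.Adj v w) : w = x ∨ w = y ∨ w = z := by
  obtain ⟨r, s, t, h1, h2, h3, h⟩ := deg_eq_three_iff.1 hv
  rw [h] at hx hy hz hw
  grind

variable {A : Set V}

/-- Since `k ≥ 2`, each edge of the path has an inner end, which lies outside `V(R)`. -/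
lemma IsRimPath.adj_deleteEdges (h : IsRimPath G R hub a k x) {i : ℕ} (hi : i < k) :
    (G.deleteEdges R).Adj (x i) (x (i + 1)) := by
  have hk := h.two_le
  rcases Nat.eq_zero_or_pos i with rfl | h0
  · exact (adj_deleteEdges_of_notMem_ends (h.inner 1 (by omega) (by omega)).notMem
      (h.adj 0 hi).symm).symm
  · exact adj_deleteEdges_of_notMem_ends (h.inner i h0 hi).notMem (h.adj i hi)

lemma IsRimPath.mem_iff (h : IsRimPath G R hub a k x) (hA : IsSide (G.deleteEdges R) A) :
    ∀ i ≤ k, (x i ∈ A ↔ (x 0 ∈ A ↔ Even i)) := by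
  intro i
  induction i with
  | zero => simp
  | succ i ih =>
    intro hi
    have h1 := hA (h.adj_deleteEdges (i := i) (by omega))
    have h2 := ih (by omega)
    rw [Nat.even_add_one]
    tauto

/-- The 4-cycle at `y` passes through `x`, and its noncubic vertex opposite to `y` is a neighbour of
`x`. The only noncubic neighbour of `x` is its hub, so the new 4-cycle uses the same two hubs. -/
lemma IsInner.step [Finite V] (hG : IsRBrick G R) (hfree : ∀ f : Sym2 V, ¬ IsStrictlyRThin G R f)
    (hA : IsSide (G.deleteEdges R) A) (hhub : ∀ x y, (x ∈ A ↔ y ∈ A) → hub x = hub y)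
    (hdeg : ∀ x, deg G (hub x) ≠ 3) {x y : V} (hx : IsInner G R hub x) (hxy : G.Adj x y)
    (hy : IsRim G R hub y) (hyR : y ∉ ends R) : IsInner G R hub y := by
  refine ⟨hy, hyR, ?_⟩
  obtain ⟨p, q, c, hbp, hbq, hpq, hN, hcy, hc, h⟩ :=
    (hy.thin.resolve_left hyR).1.exists_neighbors hG hfree hy.deg_eq (hdeg y)
  have hxpq : x = p ∨ x = q := by
    rcases (hN x).1 hxy.symm with h1 | h1
    · exact absurd (h1 ▸ hx.isRim.deg_eq) (hdeg y)
    · exact h1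
  have hcx : c = hub x := by
    obtain ⟨p', q', -, -, -, hN', hp', hq'⟩ := hx.neighbors
    rcases (hN' c).1 (SimpleGraph.deleteEdges_le _ (h x hxpq).2.1) with h1 | h1 | h1
    · exact h1
    · exact absurd (h1 ▸ hp'.deg_eq) hc
    · exact absurd (h1 ▸ hq'.deg_eq) hc
  have hrim : ∀ z, z = p ∨ z = q → IsRim G R hub z := by
    intro z hz
    have h1 := hA (adj_deleteEdges_of_notMem_ends hyR hxy.symm)
    have h2 := hA (adj_deleteEdges_of_notMem_ends hyR ((hN z).2 (Or.inr hz)))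
    have h3 : c = hub z := hcx.trans (hhub _ _ (by tauto))
    have h4 := h z hz
    rw [h3] at h4
    exact ⟨h4.1, h4.2.1, h4.2.2⟩
  exact ⟨p, q, hpq, hbp, hbq, hN, hrim p (by simp), hrim q (by simp)⟩

/-- The two hubs together with a set of rim vertices closed under adjacency cannot exhaust `V(R)`
unless the rim contains vertices of `V(R)` in both colour classes. -/
lemma IsRBrick.false_of_closed [Finite V] (hG : IsRBrick G R) (hA : IsSide (G.deleteEdges R) A)
    {b c u v : V} (hbA : b ∉ A) (hcA : c ∈ A) {X : Set V} (hX : X.Nonempty) (hbX : b ∉ X)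
    (hcX : c ∉ X) (hcl : ∀ x ∈ X, ∀ y, G.Adj x y → y ∈ X ∨ y = b ∨ y = c)
    (hends : ∀ x ∈ X, x ∈ ends R → x = u ∨ x = v) (huv : u ∈ A ↔ v ∈ A) : False := by
  obtain ⟨x, hx⟩ := hX
  -- Deleting `b` and `c` leaves a connected graph, so `X` is everything else. Then `V(R)` lies in
  -- `{b, c, u, v}`, and the class not containing `u`, `v` has only one candidate for the two ends
  -- of its `R`-edge.
  have h1 := mem_of_connected (hG.isBrick.threeConnected.connected_compl {b, c}
    ((Set.ncard_insert_le _ _).trans (by rw [Set.ncard_singleton]))) (x := x) (T := X)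
    (by
      rintro (rfl | rfl)
      · exact hbX hx
      · exact hcX hx) hx (by
      intro y _ hy z hz hyz
      rcases hcl y hy z hyz with h | h | h
      · exact h
      · exact absurd (Or.inl h) hz
      · exact absurd (Or.inr h) hz)
  have h2 : ∀ y ∈ ends R, y = b ∨ y = c ∨ y = u ∨ y = v := by
    intro y hy
    by_cases hyX : y ∈ X
    · exact Or.inr (Or.inr (hends y hyX hy))
    · by_contra hcon
      refine hyX (h1 ?_)
      simp only [Set.mem_compl_iff, Set.mem_insert_iff, Set.mem_singleton_iff]
      tauto
  obtain ⟨a₁, ha1, a₂, ha2, b₁, hb1, b₂, hb2, hR⟩ := hG.exists_eq_pair hA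
  have m1 : s(a₁, a₂) ∈ R := by rw [hR]; simp
  have m2 : s(b₁, b₂) ∈ R := by rw [hR]; simp
  have n1 : a₁ ≠ a₂ := (show G.Adj a₁ a₂ from hG.isRemovableDoubleton.subset_edgeSet m1).ne
  have n2 : b₁ ≠ b₂ := (show G.Adj b₁ b₂ from hG.isRemovableDoubleton.subset_edgeSet m2).ne
  have e1 := h2 a₁ ⟨_, m1, by simp⟩
  have e2 := h2 a₂ ⟨_, m1, by simp⟩
  have e3 := h2 b₁ ⟨_, m2, by simp⟩
  have e4 := h2 b₂ ⟨_, m2, by simp⟩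
  by_cases hu : u ∈ A
  · have hv := huv.1 hu
    have key : ∀ y, y ∉ A → y = b ∨ y = c ∨ y = u ∨ y = v → y = b := by
      rintro y hy (h | rfl | rfl | rfl) <;> [exact h; contradiction; contradiction; contradiction]
    exact n2 ((key _ hb1 e3).trans (key _ hb2 e4).symm)
  · have hv := fun h ↦ hu (huv.2 h)
    have key : ∀ y, y ∈ A → y = b ∨ y = c ∨ y = u ∨ y = v → y = c := by
      rintro y hy (rfl | h | rfl | rfl) <;> [contradiction; exact h; contradiction; contradiction]
    exact n1 ((key _ ha1 e1).trans (key _ ha2 e2).symm)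

/-- The path closes to a cycle on which each vertex has two cycle neighbours and its hub, so no edge
leaves the cycle except to the hubs. -/
lemma IsRimPath.false_of_adj_ends [Finite V] (h : IsRimPath G R hub a k x) (hG : IsRBrick G R)
    (hA : IsSide (G.deleteEdges R) A) {b c : V} (hbA : b ∉ A) (hcA : c ∈ A)
    (hhub : ∀ z, hub z = b ∨ hub z = c) (hb : deg G b ≠ 3) (hc : deg G c ≠ 3)
    (hadj : G.Adj (x 0) (x k)) (hR : x k ∈ ends R → (x 0 ∈ A ↔ x k ∈ A)) : False := by
  have hk := h.two_le
  set X : Set V := {z | ∃ i ≤ k, x i = z} with hXdef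
  have hle : G.deleteEdges R ≤ G := SimpleGraph.deleteEdges_le _
  have hcub : ∀ z ∈ X, deg G z = 3 := by rintro _ ⟨i, hi, rfl⟩; exact (h.rim i hi).deg_eq
  have hbX : b ∉ X := fun hX ↦ hb (hcub _ hX)
  have hcX : c ∉ X := fun hX ↦ hc (hcub _ hX)
  have hhubX : ∀ z, hub z ∉ X := fun z ↦ by rcases hhub z with h | h <;> rw [h] <;> assumption
  have hsucc : ∀ i ≤ k, ∀ y z, y ∈ X → z ∈ X → y ≠ z → G.Adj (x i) y → G.Adj (x i) z →
      ∀ w, G.Adj (x i) w → w ∈ X ∨ w = b ∨ w = c := by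
    intro i hi y z hy hz hyz hxy hxz w hw
    rcases eq_of_adj_of_deg_eq_three (h.rim i hi).deg_eq hxy hxz (hle (h.rim i hi).adj) hyz
      (fun h' ↦ hhubX (x i) (h' ▸ hy)) (fun h' ↦ hhubX (x i) (h' ▸ hz)) hw with h' | h' | h'
    · exact Or.inl (h' ▸ hy)
    · exact Or.inl (h' ▸ hz)
    · exact Or.inr (h' ▸ hhub _)
  have hne : ∀ i j, i ≤ k → j ≤ k → i ≠ j → x i ≠ x j := fun i j hi hj hij h' ↦
    hij (h.injOn i hi j hj h')
  have hmem : ∀ i, i ≤ k → x i ∈ X := fun i hi ↦ ⟨i, hi, rfl⟩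
  have hprev : ∀ i, 0 < i → i ≤ k → G.Adj (x i) (x (i - 1)) := fun i h0 hi ↦ by
    have := h.adj (i - 1) (by omega)
    rw [Nat.sub_add_cancel h0] at this
    exact this.symm
  have hends : ∀ z ∈ X, z ∈ ends R → z = x 0 ∨ z = x k := by
    rintro _ ⟨i, hi, rfl⟩ hzR
    by_contra! hcon
    refine (h.inner i (Nat.pos_of_ne_zero ?_) (lt_of_le_of_ne hi ?_)).notMem hzR
    · rintro rfl; exact hcon.1 rfl
    · rintro rfl; exact hcon.2 rfl
  have hcl : ∀ z ∈ X, ∀ w, G.Adj z w → w ∈ X ∨ w = b ∨ w = c := by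
    rintro _ ⟨i, hi, rfl⟩
    rcases Nat.eq_zero_or_pos i with rfl | h0
    · exact hsucc 0 hi (x 1) (x k) (hmem _ (by omega)) (hmem _ le_rfl)
        (hne _ _ (by omega) le_rfl (by omega)) (h.adj 0 (by omega)) hadj
    rcases hi.eq_or_lt with rfl | hlt
    · exact hsucc i hi (x (i - 1)) (x 0) (hmem _ (by omega)) (hmem _ (by omega))
        (hne _ _ (by omega) (by omega) (by omega)) (hprev i h0 hi) hadj.symm
    · exact hsucc i hi (x (i - 1)) (x (i + 1)) (hmem _ (by omega)) (hmem _ (by omega))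
        (hne _ _ (by omega) (by omega) (by omega)) (hprev i h0 hi) (h.adj i hlt)
  by_cases hkR : x k ∈ ends R
  · exact hG.false_of_closed hA hbA hcA ⟨x 0, hmem 0 (by omega)⟩ hbX hcX hcl hends (hR hkR)
  · refine hG.false_of_closed hA hbA hcA ⟨x 0, hmem 0 (by omega)⟩ hbX hcX hcl
      (u := x 0) (v := x 0) (fun z hz hzR ↦ ?_) Iff.rfl
    rcases hends z hz hzR with h' | h'
    · exact Or.inl h'
    · exact absurd (h' ▸ hzR) hkR

/-- The last vertex of a longest rim path lies in `V(R)`. -/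
lemma IsRimPath.last_mem_ends [Finite V] (h : IsRimPath G R hub a k x) (hG : IsRBrick G R)
    (hfree : ∀ f : Sym2 V, ¬ IsStrictlyRThin G R f)
    (hA : IsSide (G.deleteEdges R) A) {b c : V} (hbA : b ∉ A) (hcA : c ∈ A)
    (hhub : ∀ x y, (x ∈ A ↔ y ∈ A) → hub x = hub y)
    (hhub' : ∀ z, hub z = b ∨ hub z = c) (hb : deg G b ≠ 3) (hc : deg G c ≠ 3)
    (hmax : ∀ y, ¬ IsRimPath G R hub a (k + 1) y) : x k ∈ ends R := by
  by_contra hkR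
  have hk := h.two_le
  have hdeg : ∀ z, deg G (hub z) ≠ 3 := fun z ↦ by
    rcases hhub' z with h | h <;> rw [h] <;> assumption
  have hprev : G.Adj (x (k - 1)) (x k) := by
    have := h.adj (k - 1) (by omega)
    rwa [Nat.sub_add_cancel (by omega)] at this
  have hkI := (h.inner (k - 1) (by omega) (by omega)).step hG hfree hA hhub hdeg hprev
    (h.rim k le_rfl) hkR
  obtain ⟨z, hz1, hz2, hz3, hzr⟩ : ∃ z, z ≠ x (k - 1) ∧ z ≠ hub (x k) ∧ G.Adj (x k) z ∧
      IsRim G R hub z := by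
    obtain ⟨p, q, hpq, hp, hq, hN, hp', hq'⟩ := hkI.neighbors
    rcases (hN _).1 hprev.symm with h1 | h1 | h1
    · exact absurd (h1 ▸ (h.rim (k - 1) (by omega)).deg_eq) (hdeg _)
    · exact ⟨q, by rw [h1]; exact hpq.symm, hq.symm, (hN q).2 (by tauto), hq'⟩
    · exact ⟨p, by rw [h1]; exact hpq, hp.symm, (hN p).2 (by tauto), hp'⟩
  -- The next vertex `z` cannot be internal to the path, which would give it degree four; it cannot
  -- be `x 0`, which would close a cycle; and a new vertex would lengthen the path.
  by_cases hzx : ∃ i ≤ k, x i = z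
  · obtain ⟨i, hi, rfl⟩ := hzx
    rcases Nat.eq_zero_or_pos i with rfl | h0
    · exact h.false_of_adj_ends hG hA hbA hcA hhub' hb hc hz3.symm (fun h' ↦ absurd h' hkR)
    have hik : i ≠ k := by rintro rfl; exact hz3.ne rfl
    have hik' : i ≠ k - 1 := by rintro rfl; exact hz1 rfl
    have h1 := h.adj i (by omega)
    have h2 := h.adj (i - 1) (by omega)
    rw [Nat.sub_add_cancel h0] at h2
    have hne : ∀ i j, i ≤ k → j ≤ k → i ≠ j → x i ≠ x j := fun i j hi hj hij h' ↦
      hij (h.injOn i hi j hj h')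
    have h3 := eq_of_adj_of_deg_eq_three (h.rim i hi).deg_eq h1 h2.symm hz3.symm
      (hne _ _ (by omega) (by omega) (by omega)) (hne _ _ (by omega) (by omega) (by omega))
      (hne _ _ (by omega) (by omega) (by omega))
      (SimpleGraph.deleteEdges_le _ (h.rim i hi).adj)
    rcases h3 with h3 | h3 | h3
    · exact hdeg _ (h3 ▸ (h.rim (i + 1) (by omega)).deg_eq)
    · exact hdeg _ (h3 ▸ (h.rim (i - 1) (by omega)).deg_eq)
    · exact hdeg _ (h3 ▸ (h.rim k le_rfl).deg_eq)
  · push Not at hzx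
    refine hmax (fun i ↦ if i ≤ k then x i else z) ⟨?_, ?_, ?_, ?_, ?_⟩
    · intro i hi j hj hij
      by_cases h1 : i ≤ k <;> by_cases h2 : j ≤ k <;> simp only [h1, h2, if_true, if_false] at hij
      · exact h.injOn i h1 j h2 hij
      · exact absurd hij (hzx i h1)
      · exact absurd hij.symm (hzx j h2)
      · omega
    · intro i hi
      by_cases h1 : i + 1 ≤ k
      · simp only [h1, if_true, show i ≤ k by omega]
        exact h.adj i h1
      · obtain rfl : i = k := by omega
        simpa using hz3
    · intro i hi
      by_cases h1 : i ≤ k <;> simp only [h1, if_true, if_false]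
      · exact h.rim i h1
      · exact hzr
    · intro i h0 hi
      simp only [show i ≤ k by omega, if_true]
      by_cases h1 : i = k
      · rw [h1]; exact hkI
      · exact h.inner i h0 (by omega)
    · obtain ⟨i, h0, h1, h2⟩ := h.mem
      exact ⟨i, h0, by omega, by simp [h1.le, h2]⟩

/-- The partial biwheel formed by a rim path of odd length and its hubs. -/
def IsRimPath.biwheel {j : ℕ} (h : IsRimPath G R hub a (2 * j + 1) x)
    (hA : IsSide (G.deleteEdges R) A) (hhub : ∀ x y, (x ∈ A ↔ y ∈ A) → hub x = hub y)
    (hhub' : ∀ x y, (x ∈ A ↔ y ∉ A) → hub x ≠ hub y) (hdeg : ∀ z, deg G (hub z) ≠ 3) :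
    PartialBiwheel (G.deleteEdges R) where
  j := j
  one_le_j := by have := h.two_le; omega
  x i := x i.val
  u := hub (x 0)
  w := hub (x 1)
  x_injective i i' hii := Fin.ext (h.injOn i (by omega) i' (by omega) hii)
  u_ne_w := hhub' _ _ (hA (h.adj_deleteEdges (i := 0) (by omega)))
  x_ne_u i hi := hdeg _ (hi ▸ (h.rim i (by omega)).deg_eq)
  x_ne_w i hi := hdeg _ (hi ▸ (h.rim i (by omega)).deg_eq)
  adj_path i := h.adj_deleteEdges i.2
  adj_u i hi := by
    have h1 := h.mem_iff hA i (by omega)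
    rw [hhub (x 0) (x i) (by tauto)]
    exact (h.rim i (by omega)).adj.symm
  adj_w i hi := by
    have h1 := h.mem_iff hA i (by omega)
    have h2 := h.mem_iff hA 1 (by omega)
    have h3 : ¬ Even 1 := by decide
    rw [← Nat.not_even_iff_odd] at hi
    rw [hhub (x 1) (x i) (by tauto)]
    exact (h.rim i (by omega)).adj.symm

lemma IsRimPath.spoke_biwheel {j : ℕ} (h : IsRimPath G R hub a (2 * j + 1) x)
    (hA : IsSide (G.deleteEdges R) A) (hhub : ∀ x y, (x ∈ A ↔ y ∈ A) → hub x = hub y)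
    (hhub' : ∀ x y, (x ∈ A ↔ y ∉ A) → hub x ≠ hub y) (hdeg : ∀ z, deg G (hub z) ≠ 3)
    (i : Fin (2 * j + 1 + 1)) :
    (h.biwheel hA hhub hhub' hdeg).spoke i = s(x i, hub (x i)) := by
  have h1 := h.mem_iff hA i (by omega)
  have h2 := h.mem_iff hA 1 (by omega)
  have h3 : ¬ Even 1 := by decide
  change (if Even i.val then s(hub (x 0), x i) else s(hub (x 1), x i)) = _
  split_ifs with hi
  · rw [hhub (x 0) (x i) (by tauto), Sym2.eq_swap]
  · rw [hhub (x 1) (x i) (by tauto), Sym2.eq_swap]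

end rim

end NearBipartite

/-! ### The `R`-biwheel theorem -/

open NearBipartite in
theorem theorem3p3 {V : Type*} [Finite V] (G : SimpleGraph V) (R : Set (Sym2 V))
    (hG : IsRBrick G R) (hfree : ∀ f : Sym2 V, ¬ IsStrictlyRThin G R f)
    (e : Sym2 V) (he : IsRThin G R e) (hindex : index G e = 1) :
    ∃ K : PartialBiwheel (G.deleteEdges R),
      IsRBiwheelConfiguration G R K ∧ e ∈ K.internalSpokes := by
  classical
  obtain ⟨a, b, rfl, ha, hb⟩ := he.exists_cubic_end hG hindex
  obtain ⟨p, q, c, hbp, hbq, hpq, hN, hca, hc, hpqc⟩ := he.exists_neighbors hG hfree ha hb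
  obtain ⟨A, haA, hA⟩ := exists_isSide hG.isRemovableDoubleton.isBipartite a
  have haR := he.1.notMem_ends hG ha
  have hbA := hA.notMem haA he.1.adj
  have hpqA : ∀ z, z = p ∨ z = q → z ∉ A := fun z hz ↦
    hA.notMem haA (adj_deleteEdges_of_notMem_ends haR ((hN z).2 (Or.inr hz)))
  have hcA : c ∈ A := hA.mem (hpqA p (Or.inl rfl)) (hpqc p (Or.inl rfl)).2.1
  have hbc : b ≠ c := by rintro rfl; exact hbA hcA
  -- The hub depends only on the colour class: `b` serves the class of `a`, and `c` the class of `p`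
  -- and `q`.
  obtain ⟨hub, hhubA, hhubB⟩ : ∃ hub : V → V, (∀ z ∈ A, hub z = b) ∧ ∀ z ∉ A, hub z = c :=
    ⟨fun z ↦ if z ∈ A then b else c, fun z hz ↦ by simp [hz], fun z hz ↦ by simp [hz]⟩
  have hhub₁ : ∀ x y, (x ∈ A ↔ y ∈ A) → hub x = hub y := fun x y hxy ↦ by
    by_cases hx : x ∈ A
    · rw [hhubA x hx, hhubA y (hxy.1 hx)]
    · rw [hhubB x hx, hhubB y (fun h ↦ hx (hxy.2 h))]
  have hhub₂ : ∀ x y, (x ∈ A ↔ y ∉ A) → hub x ≠ hub y := fun x y hxy ↦ by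
    by_cases hx : x ∈ A
    · rw [hhubA x hx, hhubB y (hxy.1 hx)]; exact hbc
    · rw [hhubB x hx, hhubA y (by tauto)]; exact hbc.symm
  have hhub₃ : ∀ z, hub z = b ∨ hub z = c := fun z ↦ by
    by_cases hz : z ∈ A
    · exact Or.inl (hhubA z hz)
    · exact Or.inr (hhubB z hz)
  have hdeg : ∀ z, deg G (hub z) ≠ 3 := fun z ↦ by
    rcases hhub₃ z with h | h <;> rw [h] <;> assumption
  have hrim : ∀ z, z = p ∨ z = q → IsRim G R hub z := fun z hz ↦ by
    have h1 := hpqc z hz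
    rw [← hhubB z (hpqA z hz)] at h1
    exact ⟨h1.1, h1.2.1, h1.2.2⟩
  have hab := hhubA a haA
  have haI : IsInner G R hub a := by
    refine ⟨⟨ha, by rw [hab]; exact he.1.adj, Or.inr (by rw [hab]; exact ⟨he, hindex⟩)⟩, haR,
      p, q, hpq, ?_, ?_, ?_, hrim p (Or.inl rfl), hrim q (Or.inr rfl)⟩ <;> rwa [hab]
  have hap := (hN p).2 (by tauto)
  have haq := (hN q).2 (by tauto)
  have hstart : IsRimPath G R hub a 2
      (fun i ↦ if i = 0 then p else if i = 1 then a else q) := by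
    have := hap.ne
    have := haq.ne
    refine ⟨?_, ?_, ?_, ?_, ⟨1, by simp, by simp, by simp⟩⟩
    · intro i hi j hj
      interval_cases i <;> interval_cases j <;> simp <;> tauto
    · intro i hi
      interval_cases i
      · simpa using hap.symm
      · simpa using haq
    · intro i hi
      interval_cases i
      · simpa using hrim p (Or.inl rfl)
      · simpa using haI.isRim
      · simpa using hrim q (Or.inr rfl)
    · intro i h0 h2
      interval_cases i
      simpa using haI
  -- A longest rim path through `a` exists: `p a q` is one, and all of them are shorter than
  -- `Nat.card V`.
  obtain ⟨k, ⟨x, hx⟩, hmax⟩ := Set.exists_max_image {k | ∃ x, IsRimPath G R hub a k x} id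
    ((Set.finite_Iio (Nat.card V)).subset fun k ⟨_, hx⟩ ↦ hx.lt_card) ⟨2, _, hstart⟩
  have hmax' : ∀ y, ¬ IsRimPath G R hub a (k + 1) y := fun y hy ↦ by
    have := hmax (k + 1) ⟨y, hy⟩
    simp at this
  have hlast := hx.last_mem_ends hG hfree hA hbA hcA hhub₁ hhub₃ hb hc hmax'
  have hfirst := hx.reverse.last_mem_ends hG hfree hA hbA hcA hhub₁ hhub₃ hb hc hmax'
  rw [Nat.sub_self] at hfirst
  have hk := hx.two_le
  -- For even `k` both ends lie in one colour class and in `V(R)`. That class contains just one edge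
  -- of `R`, which therefore joins them and closes the path to a cycle.
  have hodd : ¬ Even k := fun hev ↦ by
    have h1 := hx.mem_iff hA k le_rfl
    have h2 : x 0 ∈ A ↔ x k ∈ A := by tauto
    have h3 : x 0 ≠ x k := fun h ↦ by have := hx.injOn 0 (by omega) k le_rfl h; omega
    refine hx.false_of_adj_ends hG hA hbA hcA hhub₃ hb hc ?_ (fun _ ↦ h2)
    refine hG.isRemovableDoubleton.subset_edgeSet (?_ : s(x 0, x k) ∈ R)
    obtain ⟨a₁, ha1, a₂, ha2, b₁, hb1, b₂, hb2, rfl⟩ := hG.exists_eq_pair hA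
    simp only [ends, Set.mem_insert_iff, Set.mem_singleton_iff, Set.mem_ofPred_eq,
      exists_eq_or_imp, exists_eq_left, Sym2.mem_iff] at hfirst hlast
    simp only [Set.mem_insert_iff, Set.mem_singleton_iff, Sym2.eq_iff]
    grind
  obtain ⟨j, rfl⟩ := Nat.not_even_iff_odd.1 hodd
  have hspoke := hx.spoke_biwheel hA hhub₁ hhub₂ hdeg
  refine ⟨hx.biwheel hA hhub₁ hhub₂ hdeg,
    ⟨hdeg _, hdeg _, fun i ↦ (hx.rim i (Nat.lt_succ_iff.1 i.2)).deg_eq, hfirst, hlast, ?_⟩, ?_⟩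
  · rintro f ⟨i, h0, h1, rfl⟩
    change Fin (2 * j + 1 + 1) at i
    rw [hspoke i]
    refine (hx.inner i ?_ ?_).thin
    · exact Nat.pos_of_ne_zero fun h ↦ h0 (Fin.ext h)
    · refine lt_of_le_of_ne (by omega) fun h ↦ h1 (Fin.ext h)
  · obtain ⟨i, h0, h1, h2⟩ := hx.mem
    refine ⟨(⟨i, by omega⟩ : Fin (2 * j + 1 + 1)), fun h ↦ ?_, fun h ↦ ?_, ?_⟩
    · exact h0.ne' (congrArg Fin.val h)
    · exact h1.ne (congrArg Fin.val h)
    · rw [hspoke]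
      simp only [h2, hab]
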